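/- Let $d\ge 1$, let $|\cdot|$ be any norm on $\mathbb R^d$, let $B(x,r)=\{x':|x-x'|\le r\}$, and let $v_d$ be the Lebesgue volume of $B(0,1)$. Let $X_1,X_2,\dots$ be i.i.d. with law $\mu_X$ on $\mathbb R^d$ and let $X'_1,X'_2,\dots$ be i.i.d. with law $\mu_{X'}$ on $\mathbb R^d$, the two families being independent of each other; $X$ and $X'$ denote generic variables with laws $\mu_X$ and $\mu_{X'}$. Write $\mathbf X_n=(X_1,\dots,X_n)$, $\mathbf X'_m=(X'_1,\dots,X'_m)$ and $\hat\mu_{\mathbf X_n}=\frac1n\sum_{i=1}^n\delta_{X_i}$. For $1\le k\le m$ let $$\hat\mu^{(k)}_{\mathbf X'_m}=\frac1m\sum_{j=1}^m w_j^{(k)}\delta_{X'_j},\qquad w^{(k)}_j=\frac{m}{kn}\sum_{i=1}^n\sum_{l=1}^k \mathbf 1_{\{j=j_i^{(l)}\}},$$ where $j_i^{(l)}$ is the lowest index $j$ such that $X'_j$ is equal to the $l$-th nearest neighbor of $X_i$ among $X'_1,\dots,X'_m$; here the sample points are ordered by increasing distance $|X_i-X'_j|$, equal distances being ordered by increasing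 index. For $q\ge 1$ let $$W_q(\mu,\nu)=\Big(\inf_{\gamma}\int|x-x'|^q\,d\gamma(x,x')\Big)^{1/q},$$ the infimum being over all couplings $\gamma$ of $\mu$ and $\nu$. Assume the following. 1. (Min-integrability) There is an integer $m_0\ge1$ with $\mathbb E[\min_{1\le j\le m_0}|X'_j|]<+\infty$. 2. (Strong support condition) There is an open set $U\subset\mathbb R^d$ containing the support of $\mu_X$ such that $\mu_{X'}(\cdot\cap U)$ has a density $p_{X'}$ with respect to the Lebesgue measure, $p_{X'}$ is continuous and positive on $U$, and there are $\kappa\in(0,1]$ and $r_\kappa>0$ with $$\mathbb P(X'\in B(x,r))\ \ge\ \kappa\, p_{X'}(x)\, v_d\, r^d\qquad\text{for all }x\in U,\ r\in[0,r_\kappa].$$ 3. (Moments) The number $q\in[1,+\infty)$ is such that $\mathbb E\big[(1+|X|^q)\,p_{X'}(X)^{-q/d}\big]<+\infty$. Let $(k_m)_{m\ge1}$ be a nondecreasing sequence of positive integers with $k_m/m\to0$ as $m\to+\infty$, and define $$c_{d,q}=\begin{cases}\dfrac{2^{q/d+1}}{k}\displaystyle\sum_{l=1}^k\Big(\frac lk\Big)^{q/d}&\text{if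 }\sup_{m\ge1}k_m=k<+\infty,\\[2ex]\dfrac{2^{q/d+1}}{q/d+1}&\text{if }\sup_{m\ge1}k_m=+\infty.\end{cases}$$ Then $1<c_{d,q}\le 2^{q/d+1}$ and, for every sequence $(n_m)_{m\ge1}$ of positive integers (in particular for a fixed $n$, $n_m=n$), $$\limsup_{m\to+\infty}\Big(\frac m{k_m}\Big)^{q/d}\,\mathbb E\Big[W_q^q\big(\hat\mu_{\mathbf X_{n_m}},\hat\mu^{(k_m)}_{\mathbf X'_m}\big)\Big]\ \le\ c_{d,q}\,\frac{\Gamma(1+q/d)}{v_d^{q/d}}\;\mathbb E\left[\frac1{p_{X'}(X)^{q/d}}\right].$$ -/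

import Mathlib

open MeasureTheory ProbabilityTheory Filter Topology
open scoped ENNReal NNReal

namespace NNRates

noncomputable section

/-- The set of couplings of `μ` and `ν`: measures on `E × E` with marginals `μ` and `ν`. -/
def couplings {E : Type*} [MeasurableSpace E] (μ ν : Measure E) : Set (Measure (E × E)) :=
  {γ | γ.map Prod.fst = μ ∧ γ.map Prod.snd = ν}

/-- The Wasserstein distance of order `q` for the distance induced by the norm of `E`
(with values in `[0, ∞]`). -/
def wasserstein {E : Type*} [NormedAddCommGroup E] [MeasurableSpace E]
    (q : ℝ) (μ ν : Measure E) : ℝ≥0∞ :=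
  (⨅ γ ∈ couplings μ ν, ∫⁻ z, ‖z.1 - z.2‖ₑ ^ q ∂γ) ^ (1 / q)

/-- The weighted empirical measure `(1 / m) ∑ⱼ wⱼ δ_{x'ⱼ}`. -/
def weightedEmpiricalMeasure {E : Type*} [MeasurableSpace E] {m : ℕ}
    (x' : Fin m → E) (w : Fin m → ℝ≥0) : Measure E :=
  (m : ℝ≥0∞)⁻¹ • ∑ j, (w j : ℝ≥0∞) • Measure.dirac (x' j)

/-- The empirical measure `(1 / n) ∑ᵢ δ_{xᵢ}`. -/
def empiricalMeasure {E : Type*} [MeasurableSpace E] {n : ℕ} (x : Fin n → E) : Measure E :=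
  weightedEmpiricalMeasure x 1

/-- `nearestNeighbor x' l x` is the `(l + 1)`-th nearest neighbor of `x` among
`x' 0, …, x' (m - 1)` (so `l = 0` gives the nearest one). `Tuple.sort f` is the permutation that
lists the indices by increasing value of `f`, equal values being listed by increasing index. -/
def nearestNeighbor {E : Type*} [NormedAddCommGroup E] {m : ℕ}
    (x' : Fin m → E) (l : Fin m) (x : E) : E :=
  x' (Tuple.sort (fun j => ‖x - x' j‖) l)

open scoped Classical in
/-- The lowest index `j` such that `x' j` is the `(l + 1)`-th nearest neighbor of `x`. -/
def nearestNeighborIndex {E : Type*} [NormedAddCommGroup E] {m : ℕ}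
    (x' : Fin m → E) (l : Fin m) (x : E) : Fin m :=
  (Finset.univ.filter fun j => x' j = nearestNeighbor x' l x).min'
    ⟨Tuple.sort (fun j => ‖x - x' j‖) l, Finset.mem_filter.2 ⟨Finset.mem_univ _, rfl⟩⟩

/-- The `k`-nearest-neighbor weights of the sample `x'` for the evaluation sample `x`
(meaningful for `1 ≤ k ≤ m` and `1 ≤ n`): `wⱼ` is `m / (k n)` times the number of pairs `(i, l)`
such that `j` is the index of the `l`-th nearest neighbor of `x i`, `1 ≤ l ≤ k`. -/
def knnWeight {E : Type*} [NormedAddCommGroup E] {n m : ℕ}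
    (k : ℕ) (x : Fin n → E) (x' : Fin m → E) (j : Fin m) : ℝ≥0 :=
  (m : ℝ≥0) / ((k : ℝ≥0) * (n : ℝ≥0)) *
    ∑ i : Fin n, ∑ l ∈ Finset.univ.filter (fun l : Fin m => (l : ℕ) < k),
      if j = nearestNeighborIndex x' l (x i) then 1 else 0

/-- The reweighted empirical measure of the sample `x'` with the `k`-nearest-neighbor weights. -/
def knnMeasure {E : Type*} [NormedAddCommGroup E] [MeasurableSpace E] {n m : ℕ}
    (k : ℕ) (x : Fin n → E) (x' : Fin m → E) : Measure E :=
  weightedEmpiricalMeasure x' (knnWeight k x x')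

/-- The volume of the unit ball of `E` with respect to `vol`. -/
def unitBallVolume {E : Type*} [NormedAddCommGroup E] [MeasurableSpace E]
    (vol : Measure E) : ℝ :=
  vol.real (Metric.closedBall 0 1)

/-- The strong support condition: `U` is an open set containing the support of `μ`, on `U` the
measure `μ'` has a continuous positive density `p` with respect to `vol`, and the strong minimal
mass assumption holds on `U`. Only the values of `p` on `U` matter. -/
structure StrongSupportCondition {E : Type*} [NormedAddCommGroup E] [NormedSpace ℝ E]
    [MeasurableSpace E] (vol μ μ' : Measure E) (U : Set E) (p : E → ℝ) : Prop where
  isOpen : IsOpen U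
  support_subset : μ.support ⊆ U
  density : μ'.restrict U = (vol.restrict U).withDensity fun x => ENNReal.ofReal (p x)
  continuousOn : ContinuousOn p U
  pos : ∀ x ∈ U, 0 < p x
  minimal_mass : ∃ κ ∈ Set.Ioc (0 : ℝ) 1, ∃ rκ > (0 : ℝ), ∀ x ∈ U, ∀ r ∈ Set.Icc 0 rκ,
    κ * p x * unitBallVolume vol * r ^ Module.finrank ℝ E ≤ μ'.real (Metric.closedBall x r)

open scoped Classical in
/-- The constant for dimension `d`, order `q` and the nondecreasing sequence `k` of numbers of
neighbors; it depends on the sequence only through its supremum. -/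
def knnConst (d : ℕ) (q : ℝ) (k : ℕ → ℕ) : ℝ :=
  if BddAbove (Set.range k) then
    2 ^ (q / d + 1) / ((⨆ m, k m : ℕ) : ℝ) *
      ∑ l ∈ Finset.Icc 1 (⨆ m, k m), ((l : ℝ) / ((⨆ m, k m : ℕ) : ℝ)) ^ (q / d)
  else
    2 ^ (q / d + 1) / (q / d + 1)

end

end NNRates

namespace NNRates

/-! Sending each `X i` uniformly to its `k` nearest neighbors couples the two measures, so the
expected cost is at most the average over ranks of the expected `q`-th power of the neighbor
distance. The number of evaluation points drops out by linearity of expectation.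

Rank `l + 1` is reduced to rank one by blocks. Cut the sample into `2 (l + 1)` disjoint blocks of
size `N = m / (2 (l + 1))`. Fewer than `l + 1` points lie strictly closer than the `(l + 1)`-th
neighbor, so at least `l + 1` blocks have their minimal distance no smaller. Hence the rank `l + 1`
moment is at most twice the nearest neighbor moment for sample size `N`
(`lintegral_wasserstein_rpow_le`). As `N` is about `m / (2 (l + 1))`, rescaling by `(m / k) ^ (q /
d)` produces `2 ^ (q / d + 1) * ((l + 1) / k) ^ (q / d)`, whose average over ranks tends to the
constant.

The nearest neighbor moment at `x` is `q ∫ t ^ (q - 1) P(|x - X'| > t) ^ N dt`. Small `t` give the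
Gamma factor through `exp (-N p(x) v t ^ d)`; intermediate `t` are exponentially small by the
minimal mass bound; large `t` are geometrically small by min-integrability (`exists_nnMoment_le`).
Continuity of the density gives the sharp pointwise limsup (`limsup_nnMoment_le`), the uniform
minimal mass and the moment assumption give domination (`exists_integrable_nnMoment_le`), and the
reverse Fatou lemma integrates the limsup. -/

/-! ### The nearest neighbor transport plan -/

theorem wasserstein_rpow_le {E : Type*} [NormedAddCommGroup E] [MeasurableSpace E]
    {q : ℝ} (hq : 0 < q) {μ ν : Measure E} {γ : Measure (E × E)} (hγ : γ ∈ couplings μ ν) :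
    wasserstein q μ ν ^ q ≤ ∫⁻ z, ‖z.1 - z.2‖ₑ ^ q ∂γ := by
  rw [wasserstein, ← ENNReal.rpow_mul, one_div_mul_cancel hq.ne', ENNReal.rpow_one]
  exact iInf₂_le γ hγ

theorem apply_nearestNeighborIndex {E : Type*} [NormedAddCommGroup E] {m : ℕ}
    (x' : Fin m → E) (l : Fin m) (x : E) :
    x' (nearestNeighborIndex x' l x) = nearestNeighbor x' l x := by
  classical
  have h := Finset.min'_mem (Finset.univ.filter fun j => x' j = nearestNeighbor x' l x)
    ⟨Tuple.sort (fun j => ‖x - x' j‖) l, Finset.mem_filter.2 ⟨Finset.mem_univ _, rfl⟩⟩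
  have h2 := (Finset.mem_filter.1 h).2
  rw [nearestNeighborIndex]
  convert h2

theorem card_filter_val_lt {k m : ℕ} (hkm : k ≤ m) :
    (Finset.univ.filter (fun l : Fin m => (l : ℕ) < k)).card = k := by
  rw [Fin.card_filter_val_lt]
  exact min_eq_right hkm

/-- The plan moving each `x i` uniformly to its `k` nearest neighbors. -/
noncomputable def knnCoupling {E : Type*} [NormedAddCommGroup E] [MeasurableSpace E] {n m : ℕ}
    (k : ℕ) (x : Fin n → E) (x' : Fin m → E) : Measure (E × E) :=
  ((k : ℝ≥0∞) * n)⁻¹ • ∑ i : Fin n, ∑ l ∈ Finset.univ.filter (fun l : Fin m => (l : ℕ) < k),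
    Measure.dirac (x i, nearestNeighbor x' l (x i))

theorem knnCoupling_mem_couplings {E : Type*} [NormedAddCommGroup E] [MeasurableSpace E]
    {n m k : ℕ} (hk : 1 ≤ k) (hkm : k ≤ m) (hn : 1 ≤ n) (x : Fin n → E) (x' : Fin m → E) :
    knnCoupling k x x' ∈ couplings (empiricalMeasure x) (knnMeasure k x x') := by
  have hk0 : (k : ℝ≥0∞) ≠ 0 := by exact_mod_cast (by omega : k ≠ 0)
  have hn0 : (n : ℝ≥0∞) ≠ 0 := by exact_mod_cast (by omega : n ≠ 0)
  have hm0 : (m : ℝ≥0∞) ≠ 0 := by exact_mod_cast (by omega : m ≠ 0)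
  constructor
  · ext s hs
    rw [Measure.map_apply measurable_fst hs]
    simp only [knnCoupling, empiricalMeasure, weightedEmpiricalMeasure, Measure.smul_apply,
      Measure.finsetSum_apply, Measure.dirac_apply' _ hs,
      Measure.dirac_apply' _ (measurable_fst hs), smul_eq_mul]
    have : ∀ i : Fin n, ∀ l : Fin m,
        (Prod.fst ⁻¹' s).indicator (1 : E × E → ℝ≥0∞) (x i, nearestNeighbor x' l (x i))
          = s.indicator 1 (x i) := fun i l => rfl
    simp only [this, Finset.sum_const, card_filter_val_lt hkm, nsmul_eq_mul, Pi.one_apply,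
      ENNReal.coe_one, one_mul]
    rw [← Finset.mul_sum, ENNReal.mul_inv (Or.inl hk0) (Or.inl (ENNReal.natCast_ne_top k)),
      mul_comm (k : ℝ≥0∞)⁻¹, mul_assoc, ← mul_assoc (k : ℝ≥0∞)⁻¹,
      ENNReal.inv_mul_cancel hk0 (ENNReal.natCast_ne_top k), one_mul]
  · ext s hs
    rw [Measure.map_apply measurable_snd hs]
    simp only [knnCoupling, knnMeasure, weightedEmpiricalMeasure, Measure.smul_apply,
      Measure.finsetSum_apply, Measure.dirac_apply' _ hs,
      Measure.dirac_apply' _ (measurable_snd hs), smul_eq_mul]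
    -- Among tied indices only the location matters: passing to the lowest index with the same
    -- location leaves the Dirac mass unchanged.
    have h1 : ∀ i : Fin n, ∀ l : Fin m,
        (Prod.snd ⁻¹' s).indicator (1 : E × E → ℝ≥0∞) (x i, nearestNeighbor x' l (x i))
          = s.indicator 1 (x' (nearestNeighborIndex x' l (x i))) := fun i l => by
      rw [apply_nearestNeighborIndex x' l (x i)]; rfl
    have hkn : (k : ℝ≥0) * (n : ℝ≥0) ≠ 0 :=
      mul_ne_zero (by exact_mod_cast (by omega : k ≠ 0)) (by exact_mod_cast (by omega : n ≠ 0))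
    have h2 : ∀ j : Fin m, (knnWeight k x x' j : ℝ≥0∞) = (m : ℝ≥0∞) * ((k : ℝ≥0∞) * n)⁻¹ *
        ∑ i : Fin n, ∑ l ∈ Finset.univ.filter (fun l : Fin m => (l : ℕ) < k),
          if j = nearestNeighborIndex x' l (x i) then 1 else 0 := fun j => by
      rw [knnWeight, ENNReal.coe_mul, ENNReal.coe_div hkn]
      push_cast
      rw [ENNReal.div_eq_inv_mul, mul_comm (m : ℝ≥0∞)]
      congr 1
      refine Finset.sum_congr rfl fun i _ => Finset.sum_congr rfl fun l _ => ?_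
      split_ifs <;> rfl
    simp only [h1, h2]
    simp only [mul_assoc]
    rw [← Finset.mul_sum, ← mul_assoc (m : ℝ≥0∞)⁻¹,
      ENNReal.inv_mul_cancel hm0 (ENNReal.natCast_ne_top m), one_mul, ← Finset.mul_sum]
    congr 1
    simp only [Finset.sum_mul]
    symm
    rw [Finset.sum_comm]
    refine Finset.sum_congr rfl fun i _ => ?_
    rw [Finset.sum_comm]
    refine Finset.sum_congr rfl fun l _ => ?_
    simp

theorem wasserstein_knnMeasure_rpow_le {E : Type*} [NormedAddCommGroup E] [MeasurableSpace E]
    [MeasurableSingletonClass E] {q : ℝ} (hq : 0 < q)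
    {n m k : ℕ} (hk : 1 ≤ k) (hkm : k ≤ m) (hn : 1 ≤ n) (x : Fin n → E) (x' : Fin m → E) :
    wasserstein q (empiricalMeasure x) (knnMeasure k x x') ^ q ≤
      ((k : ℝ≥0∞) * n)⁻¹ * ∑ i : Fin n,
        ∑ l ∈ Finset.univ.filter (fun l : Fin m => (l : ℕ) < k),
          ‖x i - nearestNeighbor x' l (x i)‖ₑ ^ q := by
  refine (wasserstein_rpow_le hq (knnCoupling_mem_couplings hk hkm hn x x')).trans_eq ?_
  simp only [knnCoupling, lintegral_smul_measure, lintegral_finsetSum_measure,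
    lintegral_dirac, smul_eq_mul]

/-! ### From the `l`-th neighbor to block minima -/

/-- An index with strictly smaller distance must be sorted before position `l`. Ties are harmless
because the inequality is strict. -/
theorem card_filter_norm_sub_lt_le {E : Type*} [NormedAddCommGroup E] {m : ℕ}
    (x' : Fin m → E) (l : Fin m) (x : E) :
    (Finset.univ.filter fun j => ‖x - x' j‖ < ‖x - nearestNeighbor x' l x‖).card ≤ l := by
  set f : Fin m → ℝ := fun j => ‖x - x' j‖ with hf
  have hmono : Monotone (f ∘ Tuple.sort f) := Tuple.monotone_sort f
  have hsub : (Finset.univ.filter fun j => f j < f (Tuple.sort f l)) ⊆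
      (Finset.Iio l).map (Tuple.sort f).toEmbedding := by
    intro j hj
    rw [Finset.mem_filter] at hj
    rw [Finset.mem_map]
    refine ⟨(Tuple.sort f).symm j, ?_, by simp⟩
    rw [Finset.mem_Iio]
    by_contra hlt
    have := hmono (not_lt.1 hlt)
    simp only [Function.comp, Equiv.apply_symm_apply] at this
    exact absurd hj.2 (not_lt.2 this)
  have := Finset.card_le_card hsub
  rwa [Finset.card_map, Fin.card_Iio] at this

/-- Splitting the sample in `2 (l + 1)` blocks, at least half of them are at distance at least
that of the `(l + 1)`-th nearest neighbor. -/
theorem enorm_sub_nearestNeighbor_rpow_le {E : Type*} [NormedAddCommGroup E] {q : ℝ} (hq : 0 ≤ q)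
    {m : ℕ} (y : ℕ → E) (l : Fin m) (x : E) {N : ℕ} (hN : 2 * ((l : ℕ) + 1) * N ≤ m) :
    ((l : ℕ) + 1 : ℝ≥0∞) * ‖x - nearestNeighbor (fun j : Fin m => y j) l x‖ₑ ^ q ≤
      ∑ g ∈ Finset.range (2 * ((l : ℕ) + 1)), (⨅ r : Fin N, ‖x - y (g * N + r)‖ₑ) ^ q := by
  set D := ‖x - nearestNeighbor (fun j : Fin m => y j) l x‖ₑ with hD
  set M : ℕ → ℝ≥0∞ := fun g => ⨅ r : Fin N, ‖x - y (g * N + r)‖ₑ with hM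
  set S := Finset.range (2 * ((l : ℕ) + 1)) with hS
  -- A block with minimum below `D` contains a point strictly closer than `D`. Blocks are disjoint,
  -- so choosing one such point per block is injective, and there are at most `l` such points. The
  -- default index `0` below is never reached on these blocks.
  have hbad : (S.filter fun g => M g < D).card ≤ l := by
    refine le_trans ?_ (card_filter_norm_sub_lt_le (fun j : Fin m => y j) l x)
    have hex : ∀ g ∈ S.filter fun g => M g < D, ∃ r : ℕ, r < N ∧ ‖x - y (g * N + r)‖ₑ < D := by
      intro g hg
      obtain ⟨r, hr⟩ := iInf_lt_iff.1 (Finset.mem_filter.1 hg).2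
      exact ⟨r, r.2, hr⟩
    choose! r hr using hex
    have hlt : ∀ g ∈ S.filter fun g => M g < D, g * N + r g < m := by
      intro g hg
      have h1 := Finset.mem_range.1 (Finset.mem_filter.1 hg).1
      have h2 := (hr g hg).1
      calc g * N + r g < (g + 1) * N := by rw [add_mul, one_mul]; omega
        _ ≤ 2 * ((l : ℕ) + 1) * N := Nat.mul_le_mul_right _ h1
        _ ≤ m := hN
    have hm : 0 < m := l.pos
    refine Finset.card_le_card_of_injOn (fun g => if h : g * N + r g < m
      then (⟨g * N + r g, h⟩ : Fin m) else ⟨0, hm⟩) ?_ ?_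
    · intro g hg
      have h := hlt g hg
      simp only [h, dite_true, Finset.coe_filter, Set.mem_ofPred_eq, Finset.mem_univ, true_and]
      have := (hr g hg).2
      rwa [hD, ← not_le, enorm_le_iff_norm_le, not_le] at this
    · intro g hg g' hg' heq
      have h := hlt g hg
      have h' := hlt g' hg'
      simp only [h, h', dite_true, Fin.mk.injEq] at heq
      have h1 := (hr g hg).1
      have h2 := (hr g' hg').1
      have e1 : (g * N + r g) / N = g := by
        rw [mul_comm, Nat.mul_add_div (by omega), Nat.div_eq_of_lt h1, add_zero]
      have e2 : (g' * N + r g') / N = g' := by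
        rw [mul_comm, Nat.mul_add_div (by omega), Nat.div_eq_of_lt h2, add_zero]
      rw [← e1, ← e2, heq]
  have hgood : (l : ℕ) + 1 ≤ (S.filter fun g => ¬ M g < D).card := by
    have := Finset.card_filter_add_card_filter_not (s := S) (fun g => M g < D)
    rw [hS, Finset.card_range, ← hS] at this
    omega
  calc ((l : ℕ) + 1 : ℝ≥0∞) * D ^ q ≤ ((S.filter fun g => ¬ M g < D).card : ℝ≥0∞) * D ^ q := by
        gcongr; exact_mod_cast hgood
    _ = ∑ g ∈ S.filter fun g => ¬ M g < D, D ^ q := by rw [Finset.sum_const, nsmul_eq_mul]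
    _ ≤ ∑ g ∈ S.filter fun g => ¬ M g < D, M g ^ q := by
        refine Finset.sum_le_sum fun g hg => ENNReal.rpow_le_rpow ?_ hq
        exact not_lt.1 (Finset.mem_filter.1 hg).2
    _ ≤ ∑ g ∈ S, M g ^ q := Finset.sum_le_sum_of_subset (Finset.filter_subset _ _)

/-! ### The nearest neighbor moment as a tail integral -/

theorem pi_setOf_forall_lt_norm_sub {E : Type*} [NormedAddCommGroup E] [MeasurableSpace E]
    (μ' : Measure E) [IsProbabilityMeasure μ'] (N : ℕ) (x : E)
    (t : ℝ) : (Measure.pi fun _ : Fin N => μ') {y | ∀ r, t < ‖x - y r‖} =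
      μ' {y | t < ‖x - y‖} ^ N := by
  have : {y : Fin N → E | ∀ r, t < ‖x - y r‖} = Set.univ.pi fun _ => {y | t < ‖x - y‖} := by
    ext y; simp [Set.mem_pi]
  rw [this, Measure.pi_pi]
  simp

section Moment

variable {E : Type*} [NormedAddCommGroup E] [MeasurableSpace E] [BorelSpace E]
  [SecondCountableTopology E]

/-- The moment of order `q` of the distance from `x` to the nearest point of an i.i.d. sample of
size `N` with law `μ'`. -/
noncomputable def nnMoment (μ' : Measure E) (q : ℝ) (N : ℕ) (x : E) : ℝ≥0∞ :=
  ∫⁻ y, (⨅ r : Fin N, ‖x - y r‖ₑ) ^ q ∂(Measure.pi fun _ : Fin N => μ')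

theorem measurable_iInf_enorm_sub (q : ℝ) (N : ℕ) :
    Measurable fun z : E × (Fin N → E) => (⨅ r : Fin N, ‖z.1 - z.2 r‖ₑ) ^ q := by
  refine Measurable.pow_const (Measurable.iInf fun r => ?_) q
  exact (measurable_fst.sub ((measurable_pi_apply (X := fun _ : Fin N => E) r).comp measurable_snd)).enorm

theorem measurable_nnMoment (μ' : Measure E) [IsProbabilityMeasure μ'] (q : ℝ) (N : ℕ) :
    Measurable (nnMoment μ' q N) :=
  (measurable_iInf_enorm_sub q N).lintegral_prod_right'

/-- Layer-cake formula: by independence the minimum exceeds `t` with the `N`-th power of the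
one-point probability. For `N = 0` the infimum would be infinite. -/
theorem nnMoment_eq_lintegral (μ' : Measure E) [IsProbabilityMeasure μ'] {q : ℝ} (hq : 0 < q)
    {N : ℕ} (hN : 1 ≤ N) (x : E) :
    nnMoment μ' q N x = ENNReal.ofReal q *
      ∫⁻ t in Set.Ioi (0 : ℝ), μ' {y | t < ‖x - y‖} ^ N * ENNReal.ofReal (t ^ (q - 1)) := by
  have : Nonempty (Fin N) := ⟨⟨0, hN⟩⟩
  set f : (Fin N → E) → ℝ := fun y => (⨅ r : Fin N, ‖x - y r‖ₑ).toReal with hf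
  have hfin : ∀ y : Fin N → E, (⨅ r : Fin N, ‖x - y r‖ₑ) ≠ ⊤ := fun y =>
    ((iInf_le (fun r : Fin N => ‖x - y r‖ₑ) ⟨0, hN⟩).trans_lt enorm_lt_top).ne
  have hmeas : Measurable f := by
    refine Measurable.ennreal_toReal (Measurable.iInf fun r => ?_)
    exact (measurable_const.sub (measurable_pi_apply r)).enorm
  have h := lintegral_rpow_eq_lintegral_meas_lt_mul (Measure.pi fun _ : Fin N => μ') (f := f)
    (ae_of_all _ fun y => ENNReal.toReal_nonneg) hmeas.aemeasurable hq
  have h1 : nnMoment μ' q N x =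
      ∫⁻ y, ENNReal.ofReal (f y ^ q) ∂(Measure.pi fun _ : Fin N => μ') := by
    refine lintegral_congr fun y => ?_
    rw [← ENNReal.ofReal_rpow_of_nonneg ENNReal.toReal_nonneg hq.le,
      ENNReal.ofReal_toReal (hfin y)]
  rw [h1, h]
  congr 1
  refine setLIntegral_congr_fun measurableSet_Ioi fun t ht => ?_
  have ht0 : (0 : ℝ) ≤ t := le_of_lt ht
  have hset : {y | t < f y} = {y : Fin N → E | ∀ r, t < ‖x - y r‖} := by
    ext y
    rw [Set.mem_ofPred_eq, Set.mem_ofPred_eq, hf, ← ENNReal.ofReal_lt_iff_lt_toReal ht0 (hfin y)]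
    have hiff : ∀ r, ENNReal.ofReal t < ‖x - y r‖ₑ ↔ t < ‖x - y r‖ := fun r => by
      rw [ENNReal.ofReal_lt_iff_lt_toReal ht0 enorm_ne_top, toReal_enorm]
    constructor
    · intro hlt r
      exact (hiff r).1 (hlt.trans_le (iInf_le _ r))
    · intro hlt
      -- The infimum is attained, which preserves the strict inequality.
      obtain ⟨r, hr⟩ := exists_eq_ciInf_of_finite (f := fun r => ‖x - y r‖ₑ)
      rw [← hr]
      exact (hiff r).2 (hlt r)
  rw [hset, pi_setOf_forall_lt_norm_sub]

end Moment

/-! ### Expectations over the samples -/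

theorem map_block_eq_pi {E : Type*} [MeasurableSpace E]
    {Ω : Type*} [MeasurableSpace Ω] {P : Measure Ω} [IsProbabilityMeasure P]
    {μ' : Measure E} {X' : ℕ → Ω → E}
    (hX'law : ∀ j, HasLaw (X' j) μ' P) (hX'indep : iIndepFun X' P)
    (a N : ℕ) : P.map (fun ω (r : Fin N) => X' (a + r) ω) = Measure.pi fun _ : Fin N => μ' := by
  have hinj : Function.Injective fun r : Fin N => a + (r : ℕ) := fun r r' h => by
    ext; simpa using h
  have := (iIndepFun_iff_map_fun_eq_pi_map
    (f := fun r : Fin N => X' (a + r)) (fun r => (hX'law _).aemeasurable)).1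
    (hX'indep.precomp hinj)
  rw [this]
  congr 1
  ext1 r
  exact (hX'law _).map_eq

theorem aemeasurable_block {E : Type*} [MeasurableSpace E]
    {Ω : Type*} [MeasurableSpace Ω] {P : Measure Ω} {μ μ' : Measure E}
    {X X' : ℕ → Ω → E}
    (hXlaw : ∀ i, HasLaw (X i) μ P) (hX'law : ∀ j, HasLaw (X' j) μ' P)
    (i a N : ℕ) : AEMeasurable (fun ω => (X i ω, fun r : Fin N => X' (a + r) ω)) P :=
  (hXlaw i).aemeasurable.prodMk (aemeasurable_pi_iff.2 fun _ => (hX'law _).aemeasurable)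

section Samples

variable {E : Type*} [NormedAddCommGroup E] [MeasurableSpace E] [BorelSpace E]
  [SecondCountableTopology E]
  {Ω : Type*} [MeasurableSpace Ω] {P : Measure Ω} [IsProbabilityMeasure P]
  {μ μ' : Measure E} [IsProbabilityMeasure μ']
  {X X' : ℕ → Ω → E}

theorem lintegral_block (hXlaw : ∀ i, HasLaw (X i) μ P) (hX'law : ∀ j, HasLaw (X' j) μ' P)
    (hX'indep : iIndepFun X' P)
    (hXX' : IndepFun (fun ω i => X i ω) (fun ω j => X' j ω) P) (q : ℝ) (i a N : ℕ) :
    ∫⁻ ω, (⨅ r : Fin N, ‖X i ω - X' (a + r) ω‖ₑ) ^ q ∂P = ∫⁻ x, nnMoment μ' q N x ∂μ := by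
  have hind : IndepFun (X i) (fun ω (r : Fin N) => X' (a + r) ω) P :=
    hXX'.comp (φ := fun x : ℕ → E => x i) (ψ := fun y : ℕ → E => fun r : Fin N => y (a + r))
      (measurable_pi_apply i) (measurable_pi_lambda _ fun r => measurable_pi_apply _)
  have hmap := (indepFun_iff_map_prod_eq_prod_map_map (hXlaw i).aemeasurable
    (aemeasurable_pi_iff.2 fun _ => (hX'law _).aemeasurable)).1 hind
  rw [(hXlaw i).map_eq, map_block_eq_pi hX'law hX'indep] at hmap
  have h1 := lintegral_map' (f := fun z : E × (Fin N → E) => (⨅ r : Fin N, ‖z.1 - z.2 r‖ₑ) ^ q)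
    (measurable_iInf_enorm_sub q N).aemeasurable (aemeasurable_block hXlaw hX'law i a N)
  rw [← h1, hmap, lintegral_prod _ (measurable_iInf_enorm_sub q N).aemeasurable]
  rfl

/-- All blocks have the same law and each is independent of `X i`, so `2 (l + 1)` equal expectations
divided by `l + 1` leave a factor `2`, whatever `i` and `l`. The block size may depend on the rank.
-/
theorem lintegral_wasserstein_rpow_le (hXlaw : ∀ i, HasLaw (X i) μ P)
    (hX'law : ∀ j, HasLaw (X' j) μ' P) (hX'indep : iIndepFun X' P)
    (hXX' : IndepFun (fun ω i => X i ω) (fun ω j => X' j ω) P) {q : ℝ} (hq : 0 < q)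
    {k m n : ℕ} (hk : 1 ≤ k) (hkm : k ≤ m) (hn : 1 ≤ n)
    (N : ℕ → ℕ) (hN : ∀ l, 2 * (l + 1) * N l ≤ m) :
    ∫⁻ ω, wasserstein q (empiricalMeasure (fun i : Fin n => X i ω))
      (knnMeasure k (fun i : Fin n => X i ω) (fun j : Fin m => X' j ω)) ^ q ∂P ≤
    (k : ℝ≥0∞)⁻¹ * ∑ l ∈ Finset.range k, 2 * ∫⁻ x, nnMoment μ' q (N l) x ∂μ := by
  have hk0 : (k : ℝ≥0∞) ≠ 0 := by exact_mod_cast (by omega : k ≠ 0)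
  have hn0 : (n : ℝ≥0∞) ≠ 0 := by exact_mod_cast (by omega : n ≠ 0)
  obtain ⟨B, hB⟩ : ∃ B : ℕ → ℕ → ℕ → Ω → ℝ≥0∞, B = fun l g i ω =>
    (⨅ r : Fin (N l), ‖X i ω - X' (g * (N l) + r) ω‖ₑ) ^ q := ⟨_, rfl⟩
  have hBm : ∀ l g i, AEMeasurable (B l g i) P := fun l g i => by
    rw [hB]
    refine AEMeasurable.pow_const (AEMeasurable.iInf fun r => ?_) q
    exact ((hXlaw i).aemeasurable.sub (hX'law _).aemeasurable).enorm
  have hBi : ∀ l g i, ∫⁻ ω, B l g i ω ∂P = ∫⁻ x, nnMoment μ' q (N l) x ∂μ :=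
    fun l g i => by
    rw [hB]
    exact lintegral_block hXlaw hX'law hX'indep hXX' q i (g * N l) (N l)
  have hpt : ∀ ω, wasserstein q (empiricalMeasure (fun i : Fin n => X i ω))
      (knnMeasure k (fun i : Fin n => X i ω) (fun j : Fin m => X' j ω)) ^ q ≤
      ((k : ℝ≥0∞) * n)⁻¹ * ∑ i : Fin n,
        ∑ l ∈ Finset.univ.filter (fun l : Fin m => (l : ℕ) < k),
          ((l : ℕ) + 1 : ℝ≥0∞)⁻¹ * ∑ g ∈ Finset.range (2 * ((l : ℕ) + 1)), B l g i ω := by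
    intro ω
    refine (wasserstein_knnMeasure_rpow_le hq hk hkm hn _ _).trans ?_
    gcongr with i _ l _
    rw [mul_comm, ← div_eq_mul_inv, ENNReal.le_div_iff_mul_le (Or.inl (by simp))
      (Or.inl (by finiteness)), mul_comm]
    rw [hB]
    exact enorm_sub_nearestNeighbor_rpow_le hq.le (fun j => X' j ω) l (X i ω)
      (hN l)
  refine (lintegral_mono hpt).trans ?_
  have hc1 : ((k : ℝ≥0∞) * n)⁻¹ ≠ ⊤ := ENNReal.inv_ne_top.2 (mul_ne_zero hk0 hn0)
  rw [lintegral_const_mul' _ _ hc1, lintegral_finsetSum' _ (fun i _ => by fun_prop)]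
  have hinner : ∀ i : Fin n, ∫⁻ ω, ∑ l ∈ Finset.univ.filter (fun l : Fin m => (l : ℕ) < k),
      ((l : ℕ) + 1 : ℝ≥0∞)⁻¹ * ∑ g ∈ Finset.range (2 * ((l : ℕ) + 1)), B l g i ω ∂P =
      ∑ l ∈ Finset.range k, 2 * ∫⁻ x, nnMoment μ' q (N l) x ∂μ := by
    intro i
    rw [lintegral_finsetSum' _ (fun l _ => by fun_prop)]
    have hterm : ∀ l : Fin m, ∫⁻ ω, ((l : ℕ) + 1 : ℝ≥0∞)⁻¹ *
        ∑ g ∈ Finset.range (2 * ((l : ℕ) + 1)), B l g i ω ∂P =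
        2 * ∫⁻ x, nnMoment μ' q (N l) x ∂μ := by
      intro l
      rw [lintegral_const_mul' _ _ (by simp), lintegral_finsetSum' _ (fun g _ => hBm _ _ _)]
      simp only [hBi, Finset.sum_const, Finset.card_range, nsmul_eq_mul]
      push_cast
      rw [mul_comm (2 : ℝ≥0∞), mul_assoc, ← mul_assoc, ENNReal.inv_mul_cancel (by simp)
        (by finiteness), one_mul]
    simp only [hterm]
    refine Finset.sum_nbij (fun l : Fin m => (l : ℕ)) ?_ ?_ ?_ ?_
    · intro l hl; simpa using hl
    · intro a _ b _ h; exact Fin.ext h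
    · intro l hl
      have hl' : l < k := by simpa using hl
      exact ⟨⟨l, hl'.trans_le hkm⟩, by simpa using hl', rfl⟩
    · intro l _; rfl
  simp only [hinner, Finset.sum_const, Finset.card_univ, Fintype.card_fin, nsmul_eq_mul]
  rw [ENNReal.mul_inv (Or.inl hk0) (Or.inl (ENNReal.natCast_ne_top k)), mul_assoc,
    ← mul_assoc (n : ℝ≥0∞)⁻¹, ENNReal.inv_mul_cancel hn0 (ENNReal.natCast_ne_top n), one_mul]

end Samples

/-! ### Tails of the law of the sample -/

/-- Markov's inequality for the minimum of `m₀` points. Adding one to the expectation ensures `1 ≤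
C`, so that later `t > 4 * C` forces `t ≥ 1`. -/
theorem exists_survival_pow_le {E : Type*} [NormedAddCommGroup E] [MeasurableSpace E]
    [BorelSpace E] {Ω : Type*} [MeasurableSpace Ω] {P : Measure Ω} [IsProbabilityMeasure P]
    {μ' : Measure E} [IsProbabilityMeasure μ'] {X' : ℕ → Ω → E}
    (hX'law : ∀ j, HasLaw (X' j) μ' P) (hX'indep : iIndepFun X' P) {m₀ : ℕ}
    (hmin : ∫⁻ ω, ⨅ j : Fin m₀, ‖X' j ω‖ₑ ∂P < ∞) :
    ∃ C : ℝ, 1 ≤ C ∧ ∀ t > 0, μ' {y | t < ‖y‖} ^ m₀ ≤ ENNReal.ofReal (C / t) := by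
  set I := ∫⁻ ω, ⨅ j : Fin m₀, ‖X' j ω‖ₑ ∂P with hI
  have hg : Measurable fun y : Fin m₀ → E => ⨅ j, ‖y j‖ₑ :=
    Measurable.iInf fun r => (measurable_pi_apply r).enorm
  have hpi : ∫⁻ y, ⨅ j, ‖y j‖ₑ ∂(Measure.pi fun _ : Fin m₀ => μ') = I := by
    have hm := map_block_eq_pi hX'law hX'indep 0 m₀
    rw [← hm, lintegral_map' hg.aemeasurable
      (aemeasurable_pi_iff.2 fun _ => (hX'law _).aemeasurable)]
    simp only [zero_add, hI]
  refine ⟨I.toReal + 1, by linarith [ENNReal.toReal_nonneg (a := I)], fun t ht => ?_⟩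
  have h := mul_meas_ge_le_lintegral₀ (μ := Measure.pi fun _ : Fin m₀ => μ')
    hg.aemeasurable (ENNReal.ofReal t)
  rw [hpi] at h
  have hsub : {y : Fin m₀ → E | ∀ r, t < ‖(0 : E) - y r‖} ⊆
      {y | ENNReal.ofReal t ≤ ⨅ j, ‖y j‖ₑ} := by
    intro y hy
    show ENNReal.ofReal t ≤ ⨅ j, ‖y j‖ₑ
    refine le_iInf fun j => ?_
    rw [← ofReal_norm]
    have := hy j
    rw [zero_sub, norm_neg] at this
    exact ENNReal.ofReal_le_ofReal this.le
  have h2 := measure_mono (μ := Measure.pi fun _ : Fin m₀ => μ') hsub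
  rw [pi_setOf_forall_lt_norm_sub] at h2
  simp only [zero_sub, norm_neg] at h2
  have ht0 : ENNReal.ofReal t ≠ 0 := by simpa using ht
  calc μ' {y | t < ‖y‖} ^ m₀ ≤ I / ENNReal.ofReal t := by
        rw [ENNReal.le_div_iff_mul_le (Or.inl ht0) (Or.inl ENNReal.ofReal_ne_top), mul_comm]
        exact (mul_le_mul_right h2 _).trans h
    _ ≤ ENNReal.ofReal (I.toReal + 1) / ENNReal.ofReal t := by
        gcongr
        rw [← ENNReal.ofReal_toReal hmin.ne]
        apply ENNReal.ofReal_le_ofReal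
        simp
    _ = ENNReal.ofReal ((I.toReal + 1) / t) := (ENNReal.ofReal_div_of_pos ht).symm

section Survival

variable {E : Type*} [NormedAddCommGroup E] [MeasurableSpace E] {μ' : Measure E}

theorem survival_pow_le_of_two_mul_norm_le {C : ℝ} {m₀ : ℕ}
    (hC : ∀ t > 0, μ' {y | t < ‖y‖} ^ m₀ ≤ ENNReal.ofReal (C / t)) {x : E} {t : ℝ} (ht : 0 < t)
    (hxt : 2 * ‖x‖ ≤ t) : μ' {y | t < ‖x - y‖} ^ m₀ ≤ ENNReal.ofReal (2 * C / t) := by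
  have hsub : {y | t < ‖x - y‖} ⊆ {y | t / 2 < ‖y‖} := by
    intro y hy
    have h1 : t < ‖x - y‖ := hy
    have h2 := norm_sub_le x y
    show t / 2 < ‖y‖
    linarith
  calc μ' {y | t < ‖x - y‖} ^ m₀ ≤ μ' {y | t / 2 < ‖y‖} ^ m₀ := by gcongr
    _ ≤ ENNReal.ofReal (C / (t / 2)) := hC _ (by positivity)
    _ = ENNReal.ofReal (2 * C / t) := by congr 1; field_simp

variable [IsProbabilityMeasure μ']

/-- The sample contains `N / m₀` full groups of size `m₀`, each contributing `2 * C / t ≤ 1 / 2`.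
`K` groups are kept for decay in `t`, the others for geometric decay in `N`. -/
theorem survival_pow_le_of_large {C : ℝ} (hC1 : 1 ≤ C) {m₀ : ℕ}
    (hC : ∀ t > 0, μ' {y | t < ‖y‖} ^ m₀ ≤ ENNReal.ofReal (C / t)) {x : E} {t : ℝ}
    (hxt : 2 * ‖x‖ ≤ t) (ht : 4 * C ≤ t) {N K : ℕ} (hK : K ≤ N / m₀) :
    μ' {y | t < ‖x - y‖} ^ N ≤ ENNReal.ofReal ((2 * C / t) ^ K * (1 / 2) ^ (N / m₀ - K)) := by
  have ht0 : 0 < t := by linarith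
  calc μ' {y | t < ‖x - y‖} ^ N ≤ μ' {y | t < ‖x - y‖} ^ (m₀ * (N / m₀)) :=
        pow_le_pow_right_of_le_one' prob_le_one (Nat.mul_div_le N m₀)
    _ = (μ' {y | t < ‖x - y‖} ^ m₀) ^ (N / m₀) := pow_mul _ _ _
    _ ≤ ENNReal.ofReal (2 * C / t) ^ (N / m₀) := by
        gcongr; exact survival_pow_le_of_two_mul_norm_le hC ht0 hxt
    _ = ENNReal.ofReal ((2 * C / t) ^ (K + (N / m₀ - K))) := by
        rw [← ENNReal.ofReal_pow (by positivity), Nat.add_sub_cancel' hK]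
    _ ≤ ENNReal.ofReal ((2 * C / t) ^ K * (1 / 2) ^ (N / m₀ - K)) := by
        rw [pow_add]
        have : 2 * C / t ≤ 1 / 2 := by rw [div_le_div_iff₀ ht0 two_pos]; linarith
        gcongr

variable [BorelSpace E]

theorem survival_le_exp {x : E} {t b : ℝ} (h : b ≤ μ'.real (Metric.closedBall x t)) :
    μ' {y | t < ‖x - y‖} ≤ ENNReal.ofReal (Real.exp (-b)) := by
  have hset : {y | t < ‖x - y‖} = (Metric.closedBall x t)ᶜ := by
    ext y
    simp only [Set.mem_ofPred_eq, Set.mem_compl_iff, Metric.mem_closedBall, not_le, dist_eq_norm]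
    rw [norm_sub_rev]
  rw [hset, ← ofReal_measureReal, measureReal_compl Metric.isClosed_closedBall.measurableSet,
    probReal_univ]
  refine ENNReal.ofReal_le_ofReal ?_
  linarith [Real.add_one_le_exp (-b)]

theorem survival_pow_le_exp {x : E} {t b : ℝ} (h : b ≤ μ'.real (Metric.closedBall x t)) (N : ℕ) :
    μ' {y | t < ‖x - y‖} ^ N ≤ ENNReal.ofReal (Real.exp (-(N * b))) := by
  calc μ' {y | t < ‖x - y‖} ^ N ≤ ENNReal.ofReal (Real.exp (-b)) ^ N := by
        gcongr; exact survival_le_exp h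
    _ = ENNReal.ofReal (Real.exp (-(N * b))) := by
        rw [← ENNReal.ofReal_pow (Real.exp_nonneg _), ← Real.exp_nat_mul]
        congr 2; ring

end Survival

/-! ### Nonasymptotic bound at a point -/

theorem ofReal_mul_lintegral_rpow_mul_exp {q d b : ℝ} (hq : 0 < q) (hd : 0 < d) (hb : 0 < b) :
    ENNReal.ofReal q *
      ∫⁻ t in Set.Ioi (0 : ℝ), ENNReal.ofReal (t ^ (q - 1) * Real.exp (-b * t ^ d)) =
      ENNReal.ofReal (Real.Gamma (1 + q / d) * b ^ (-(q / d))) := by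
  rw [← ofReal_integral_eq_lintegral_ofReal
    (integrableOn_rpow_mul_exp_neg_mul_rpow (by linarith) hd hb), ← ENNReal.ofReal_mul hq.le,
    integral_rpow_mul_exp_neg_mul_rpow hd (by linarith) hb]
  · congr 1
    rw [sub_add_cancel, add_comm, Real.Gamma_add_one (by positivity), neg_div]
    ring
  · refine (ae_restrict_iff' measurableSet_Ioi).2 (ae_of_all _ fun t ht => ?_)
    have : (0 : ℝ) ≤ t := le_of_lt ht
    simp only [Pi.zero_apply]
    positivity

theorem ofReal_mul_lintegral_Ioc_rpow {q R : ℝ} (hq : 0 < q) (hR : 0 ≤ R) :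
    ENNReal.ofReal q * ∫⁻ t in Set.Ioc 0 R, ENNReal.ofReal (t ^ (q - 1)) =
      ENNReal.ofReal (R ^ q) := by
  have hint : IntegrableOn (fun t : ℝ => t ^ (q - 1)) (Set.Ioc 0 R) :=
    (intervalIntegrable_iff_integrableOn_Ioc_of_le hR).1
      (intervalIntegral.intervalIntegrable_rpow' (by linarith))
  rw [← ofReal_integral_eq_lintegral_ofReal hint, ← ENNReal.ofReal_mul hq.le,
    ← intervalIntegral.integral_of_le hR, integral_rpow (Or.inl (by linarith))]
  · congr 1
    rw [sub_add_cancel, Real.zero_rpow hq.ne']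
    field_simp
    ring
  · refine (ae_restrict_iff' measurableSet_Ioc).2 (ae_of_all _ fun t ht => ?_)
    exact Real.rpow_nonneg ht.1.le _

/-- The exponent `⌈q⌉₊ + 1` brings the total power of `t` down to at most `-2`, hence an integrable
tail. -/
theorem rpow_sub_one_mul_div_pow_le {q c t : ℝ} (hc : 0 ≤ c) (ht : 1 ≤ t) :
    t ^ (q - 1) * (c / t) ^ (⌈q⌉₊ + 1) ≤ c ^ (⌈q⌉₊ + 1) * t ^ (-2 : ℝ) := by
  have ht0 : 0 < t := by linarith
  rw [div_pow, mul_div_assoc', div_eq_mul_inv, mul_comm (t ^ (q - 1)), mul_assoc,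
    ← Real.rpow_natCast t, ← Real.rpow_neg ht0.le, ← Real.rpow_add ht0]
  gcongr
  push_cast
  linarith [Nat.le_ceil q]

/-- Nonasymptotic bound on the nearest neighbor moment at a point where the law of the sample
satisfies a minimal mass condition. -/
theorem exists_nnMoment_le {E : Type*} [NormedAddCommGroup E] [MeasurableSpace E] [BorelSpace E]
    [SecondCountableTopology E] (μ' : Measure E) [IsProbabilityMeasure μ'] {C : ℝ} (hC1 : 1 ≤ C)
    {m₀ : ℕ} (hm₀ : 1 ≤ m₀)
    (hC : ∀ t > 0, μ' {y | t < ‖y‖} ^ m₀ ≤ ENNReal.ofReal (C / t))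
    {q : ℝ} (hq : 0 < q) {d : ℕ} (hd : 1 ≤ d) :
    ∃ A : ℝ, 0 ≤ A ∧ ∃ K : ℕ, 1 ≤ K ∧ ∀ (x : E) (a r : ℝ), 0 < a → 0 < r →
      (∀ t ∈ Set.Icc 0 r, a * t ^ d ≤ μ'.real (Metric.closedBall x t)) →
      ∀ N : ℕ, K * m₀ ≤ N → nnMoment μ' q N x ≤
        ENNReal.ofReal (Real.Gamma (1 + q / d) * (N * a) ^ (-(q / d))) +
        ENNReal.ofReal ((2 * ‖x‖ + 4 * C) ^ q * Real.exp (-(N * (a * r ^ d)))) +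
        ENNReal.ofReal (A * (1 / 2) ^ (N / m₀ - K)) := by
  set K := ⌈q⌉₊ + 1 with hK
  have hint : IntegrableOn (fun t : ℝ => (2 * C) ^ K * t ^ (-2 : ℝ)) (Set.Ioi (4 * C)) :=
    (integrableOn_Ioi_rpow_of_lt (by norm_num) (by linarith)).const_mul _
  have hnn : ∀ t ∈ Set.Ioi (4 * C), 0 ≤ (2 * C) ^ K * t ^ (-2 : ℝ) := fun t ht => by
    have : (0 : ℝ) ≤ t := by linarith [Set.mem_Ioi.1 ht]
    positivity
  refine ⟨q * ∫ t in Set.Ioi (4 * C), (2 * C) ^ K * t ^ (-2 : ℝ),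
    mul_nonneg hq.le (setIntegral_nonneg measurableSet_Ioi hnn), K, by omega, ?_⟩
  intro x a r ha hr hmass N hN
  have hN1 : 1 ≤ N := le_trans (Nat.mul_le_mul (by omega : 1 ≤ K) hm₀) hN
  have hKN : K ≤ N / m₀ := (Nat.le_div_iff_mul_le (by omega)).2 hN
  have hd0 : (0 : ℝ) < d := by exact_mod_cast hd
  have hN0 : (0 : ℝ) < N := by exact_mod_cast hN1
  set R := 2 * ‖x‖ + 4 * C with hR
  have hR0 : 0 ≤ R := by positivity
  set e := Real.exp (-(N * (a * r ^ d))) with he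
  set u : ℝ := (1 / 2) ^ (N / m₀ - K) with hu
  have hu0 : 0 ≤ u := by positivity
  rw [nnMoment_eq_lintegral μ' hq hN1, ← Set.Ioc_union_Ioi_eq_Ioi hR0]
  have hsmall : ∫⁻ t in Set.Ioc 0 R,
      μ' {y | t < ‖x - y‖} ^ N * ENNReal.ofReal (t ^ (q - 1)) ≤
      (∫⁻ t in Set.Ioi (0 : ℝ),
        ENNReal.ofReal (t ^ (q - 1) * Real.exp (-(N * a) * t ^ (d : ℝ)))) +
      (∫⁻ t in Set.Ioc 0 R, ENNReal.ofReal (t ^ (q - 1))) * ENNReal.ofReal e := by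
    calc _ ≤ ∫⁻ t in Set.Ioc 0 R,
          (ENNReal.ofReal (t ^ (q - 1) * Real.exp (-(N * a) * t ^ (d : ℝ))) +
            ENNReal.ofReal (t ^ (q - 1)) * ENNReal.ofReal e) := by
          refine setLIntegral_mono' measurableSet_Ioc fun t ht => ?_
          have ht0 := ht.1
          rcases le_total t r with htr | htr
          · refine le_add_right ?_
            rw [mul_comm, ENNReal.ofReal_mul (by positivity)]
            gcongr
            refine (survival_pow_le_exp (hmass t ⟨ht0.le, htr⟩) N).trans_eq ?_
            rw [Real.rpow_natCast]
            congr 2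
            ring
          · refine le_add_left ?_
            rw [mul_comm]
            gcongr
            refine le_trans ?_ (survival_pow_le_exp (hmass r ⟨hr.le, le_rfl⟩) N)
            gcongr
      _ = (∫⁻ t in Set.Ioc 0 R,
            ENNReal.ofReal (t ^ (q - 1) * Real.exp (-(N * a) * t ^ (d : ℝ)))) +
          (∫⁻ t in Set.Ioc 0 R, ENNReal.ofReal (t ^ (q - 1))) * ENNReal.ofReal e := by
          rw [lintegral_add_left (by fun_prop), lintegral_mul_const _ (by fun_prop)]
      _ ≤ _ := by
          gcongr
          exact Set.Ioc_subset_Ioi_self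
  have hlarge : ∫⁻ t in Set.Ioi R, μ' {y | t < ‖x - y‖} ^ N * ENNReal.ofReal (t ^ (q - 1)) ≤
      (∫⁻ t in Set.Ioi (4 * C), ENNReal.ofReal ((2 * C) ^ K * t ^ (-2 : ℝ))) *
        ENNReal.ofReal u := by
    rw [← lintegral_mul_const _ (by fun_prop)]
    have hsub : Set.Ioi R ⊆ Set.Ioi (4 * C) :=
      Set.Ioi_subset_Ioi (by rw [hR]; linarith [norm_nonneg x])
    refine le_trans ?_ (lintegral_mono_set hsub)
    refine setLIntegral_mono' measurableSet_Ioi fun t ht => ?_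
    have htR : R < t := ht
    have hx := norm_nonneg x
    have ht1 : 1 ≤ t := by linarith
    have ht0 : 0 < t := by linarith
    calc μ' {y | t < ‖x - y‖} ^ N * ENNReal.ofReal (t ^ (q - 1))
        ≤ ENNReal.ofReal ((2 * C / t) ^ K * u) * ENNReal.ofReal (t ^ (q - 1)) := by
          gcongr
          exact survival_pow_le_of_large hC1 hC (by linarith) (by linarith) hKN
      _ = ENNReal.ofReal (t ^ (q - 1) * (2 * C / t) ^ K * u) := by
          rw [← ENNReal.ofReal_mul (by positivity)]
          congr 1; ring
      _ ≤ ENNReal.ofReal ((2 * C) ^ K * t ^ (-2 : ℝ) * u) := by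
          apply ENNReal.ofReal_le_ofReal
          exact mul_le_mul_of_nonneg_right
            (rpow_sub_one_mul_div_pow_le (by linarith) ht1) hu0
      _ = ENNReal.ofReal ((2 * C) ^ K * t ^ (-2 : ℝ)) * ENNReal.ofReal u :=
          ENNReal.ofReal_mul (by positivity)
  have hA : ENNReal.ofReal q *
      (∫⁻ t in Set.Ioi (4 * C), ENNReal.ofReal ((2 * C) ^ K * t ^ (-2 : ℝ))) =
      ENNReal.ofReal (q * ∫ t in Set.Ioi (4 * C), (2 * C) ^ K * t ^ (-2 : ℝ)) := by
    rw [ENNReal.ofReal_mul hq.le, ofReal_integral_eq_lintegral_ofReal hint]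
    exact (ae_restrict_iff' measurableSet_Ioi).2 (ae_of_all _ hnn)
  calc _ ≤ ENNReal.ofReal q * (((∫⁻ t in Set.Ioi (0 : ℝ),
        ENNReal.ofReal (t ^ (q - 1) * Real.exp (-(N * a) * t ^ (d : ℝ)))) +
      (∫⁻ t in Set.Ioc 0 R, ENNReal.ofReal (t ^ (q - 1))) * ENNReal.ofReal e) +
      (∫⁻ t in Set.Ioi (4 * C), ENNReal.ofReal ((2 * C) ^ K * t ^ (-2 : ℝ))) *
        ENNReal.ofReal u) := by
        gcongr
        exact (lintegral_union_le _ _ _).trans (add_le_add hsmall hlarge)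
    _ = _ := by
        rw [mul_add, mul_add, ← mul_assoc, ← mul_assoc, hA,
          ofReal_mul_lintegral_rpow_mul_exp hq hd0 (by positivity),
          ofReal_mul_lintegral_Ioc_rpow hq hR0, ← ENNReal.ofReal_mul (by positivity),
          ← ENNReal.ofReal_mul
            (mul_nonneg hq.le (setIntegral_nonneg measurableSet_Ioi hnn))]

/-! ### Elementary estimates -/

theorem unitBallVolume_pos {E : Type*} [NormedAddCommGroup E] [NormedSpace ℝ E]
    [FiniteDimensional ℝ E] [MeasurableSpace E] [BorelSpace E] (vol : Measure E)
    [vol.IsAddHaarMeasure] : 0 < unitBallVolume vol :=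
  ENNReal.toReal_pos (Metric.measure_closedBall_pos vol _ one_pos).ne' measure_closedBall_lt_top.ne

/-- Raise `y / s ≤ exp (y / s)` to the power `s`. This trades an exponential term in `N * p x` for
`(N * p x) ^ (-s)` in the domination. -/
theorem rpow_mul_exp_neg_le {s y : ℝ} (hs : 0 < s) (hy : 0 ≤ y) :
    y ^ s * Real.exp (-y) ≤ s ^ s := by
  have h1 : y / s ≤ Real.exp (y / s) := by linarith [Real.add_one_le_exp (y / s)]
  have h2 : y ≤ s * Real.exp (y / s) := by
    rw [div_le_iff₀ hs] at h1; linarith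
  have h3 : y ^ s ≤ s ^ s * Real.exp y := by
    calc y ^ s ≤ (s * Real.exp (y / s)) ^ s := Real.rpow_le_rpow hy h2 hs.le
      _ = s ^ s * Real.exp y := by
        rw [Real.mul_rpow hs.le (Real.exp_nonneg _), ← Real.exp_mul, div_mul_cancel₀ _ hs.ne']
  calc y ^ s * Real.exp (-y) ≤ s ^ s * Real.exp y * Real.exp (-y) := by gcongr
    _ = s ^ s := by rw [mul_assoc, ← Real.exp_add, add_neg_cancel, Real.exp_zero, mul_one]

theorem tendsto_add_one_rpow_mul_exp {s c : ℝ} (hc : 0 < c) :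
    Tendsto (fun N : ℕ => ((N : ℝ) + 1) ^ s * Real.exp (-(N * c))) atTop (𝓝 0) := by
  have h := ((tendsto_rpow_mul_exp_neg_mul_atTop_nhds_zero s c hc).comp
    (tendsto_atTop_add_const_right atTop (1 : ℝ) tendsto_natCast_atTop_atTop)).mul_const
      (Real.exp c)
  rw [zero_mul] at h
  refine h.congr fun N => ?_
  simp only [Function.comp]
  rw [mul_assoc, ← Real.exp_add]
  congr 2; ring

theorem tendsto_add_one_rpow_mul_half_pow {s : ℝ} {m₀ : ℕ} (hm₀ : 1 ≤ m₀) (K : ℕ) :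
    Tendsto (fun N : ℕ => ((N : ℝ) + 1) ^ s * (1 / 2 : ℝ) ^ (N / m₀ - K)) atTop (𝓝 0) := by
  have hm : (0 : ℝ) < m₀ := by exact_mod_cast hm₀
  have hl := Real.log_pos one_lt_two
  have h := (tendsto_add_one_rpow_mul_exp (s := s) (c := Real.log 2 / m₀)
    (by positivity)).mul_const (Real.exp ((K + 1) * Real.log 2))
  rw [zero_mul] at h
  refine squeeze_zero (fun N => by positivity) (fun N => ?_) h
  rw [mul_assoc, ← Real.exp_add]
  gcongr
  have h1 : (1 / 2 : ℝ) ^ (N / m₀ - K) = Real.exp (-((N / m₀ - K : ℕ) * Real.log 2)) := by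
    rw [Real.exp_neg, Real.exp_nat_mul, Real.exp_log two_pos, one_div, inv_pow]
  rw [h1, Real.exp_le_exp]
  -- The floor loses at most `1` and the truncated subtraction at most `K`.
  have h2 : (N : ℝ) / m₀ ≤ (N / m₀ - K : ℕ) + (K + 1) := by
    rw [div_le_iff₀ hm]
    have h3 : N < (N / m₀ + 1) * m₀ := by
      rw [mul_comm]; exact Nat.lt_mul_div_succ N (by omega)
    have h4 : N / m₀ + 1 ≤ (N / m₀ - K) + (K + 1) := by omega
    exact_mod_cast (h3.le.trans (Nat.mul_le_mul_right _ h4))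
  have h5 := mul_le_mul_of_nonneg_right h2 hl.le
  have h6 : (N : ℝ) * (Real.log 2 / m₀) = N / m₀ * Real.log 2 := by ring
  rw [h6]
  linarith

/-! ### Consequences of the support condition -/

theorem StrongSupportCondition.ae_mem {E : Type*} [NormedAddCommGroup E] [NormedSpace ℝ E]
    [FiniteDimensional ℝ E] [MeasurableSpace E] {vol μ μ' : Measure E} {U : Set E} {p : E → ℝ}
    (h : StrongSupportCondition vol μ μ' U p) :
    ∀ᵐ x ∂μ, x ∈ U :=
  Filter.mem_of_superset Measure.support_mem_ae h.support_subset

theorem StrongSupportCondition.aemeasurable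
    {E : Type*} [NormedAddCommGroup E] [NormedSpace ℝ E] [FiniteDimensional ℝ E]
    [MeasurableSpace E] [BorelSpace E] {vol μ μ' : Measure E} {U : Set E} {p : E → ℝ}
    (h : StrongSupportCondition vol μ μ' U p) :
    AEMeasurable p μ := by
  have := h.continuousOn.aemeasurable (μ := μ) h.isOpen.measurableSet
  rwa [Measure.restrict_eq_self_of_ae_mem h.ae_mem] at this

theorem StrongSupportCondition.integrable_one_div_rpow
    {E : Type*} [NormedAddCommGroup E] [NormedSpace ℝ E] [FiniteDimensional ℝ E]
    [MeasurableSpace E] [BorelSpace E] {vol μ μ' : Measure E} {U : Set E} {p : E → ℝ}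
    (h : StrongSupportCondition vol μ μ' U p) {q s : ℝ}
    (hmom : Integrable (fun x => (1 + ‖x‖ ^ q) / p x ^ s) μ) :
    Integrable (fun x => 1 / p x ^ s) μ := by
  refine hmom.mono ((h.aemeasurable.pow_const s).const_div 1).aestronglyMeasurable ?_
  filter_upwards [h.ae_mem] with x hx
  have hpx := h.pos x hx
  have hn : 0 ≤ ‖x‖ ^ q := by positivity
  rw [Real.norm_of_nonneg (by positivity), Real.norm_of_nonneg (by positivity)]
  gcongr
  linarith

section Density

variable {E : Type*} [NormedAddCommGroup E] [NormedSpace ℝ E] [FiniteDimensional ℝ E]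
  [MeasurableSpace E] [BorelSpace E]
  {vol : Measure E} [vol.IsAddHaarMeasure] {μ μ' : Measure E}
  {U : Set E} {p : E → ℝ}

/-- Near `x` the density exceeds `b * p x` by continuity. Compared with the minimal mass assumption,
the constant can be arbitrarily close to `1`, but the radius depends on `x`. -/
theorem StrongSupportCondition.exists_mass_ge [IsProbabilityMeasure μ']
    (h : StrongSupportCondition vol μ μ' U p) {x : E} (hx : x ∈ U) {b : ℝ} (hb0 : 0 < b)
    (hb1 : b < 1) : ∃ r > 0, ∀ t ∈ Set.Icc 0 r,
      b * p x * unitBallVolume vol * t ^ Module.finrank ℝ E ≤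
        μ'.real (Metric.closedBall x t) := by
  have hpx := h.pos x hx
  have hcont : ContinuousAt p x := h.continuousOn.continuousAt (h.isOpen.mem_nhds hx)
  have hev : ∀ᶠ y in 𝓝 x, y ∈ U ∧ b * p x < p y :=
    (h.isOpen.eventually_mem hx).and (hcont.eventually_const_lt (by nlinarith))
  obtain ⟨δ, hδ, hball⟩ := Metric.eventually_nhds_iff_ball.1 hev
  refine ⟨δ / 2, by positivity, fun t ht => ?_⟩
  have hsub : ∀ y ∈ Metric.closedBall x t, y ∈ U ∧ b * p x < p y := fun y hy =>
    hball y (Metric.closedBall_subset_ball (by linarith [ht.2]) hy)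
  have hmeas : MeasurableSet (Metric.closedBall x t) := Metric.isClosed_closedBall.measurableSet
  have hle : ENNReal.ofReal (b * p x) * vol (Metric.closedBall x t) ≤
      μ' (Metric.closedBall x t) := by
    calc ENNReal.ofReal (b * p x) * vol (Metric.closedBall x t)
        = ∫⁻ _ in Metric.closedBall x t, ENNReal.ofReal (b * p x) ∂vol := by
          rw [setLIntegral_const]
      _ ≤ ∫⁻ y in Metric.closedBall x t, ENNReal.ofReal (p y) ∂vol :=
          setLIntegral_mono' hmeas fun y hy => ENNReal.ofReal_le_ofReal (hsub y hy).2.le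
      _ = μ'.restrict U (Metric.closedBall x t) := by
          rw [h.density, withDensity_apply _ hmeas, Measure.restrict_restrict_of_subset
            fun y hy => (hsub y hy).1]
      _ ≤ μ' (Metric.closedBall x t) := Measure.restrict_apply_le _ _
  have hvol : vol.real (Metric.closedBall x t) =
      t ^ Module.finrank ℝ E * unitBallVolume vol := by
    rw [unitBallVolume, Measure.real, Measure.real, Measure.addHaar_closedBall' vol x ht.1,
      ENNReal.toReal_mul, ENNReal.toReal_ofReal (pow_nonneg ht.1 _)]
  have := ENNReal.toReal_mono (measure_ne_top _ _) hle
  rw [ENNReal.toReal_mul, ENNReal.toReal_ofReal (by positivity), ← Measure.real, ← Measure.real,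
    hvol] at this
  linarith

/-! ### Limits of the rescaled moments -/

/-- Of the three terms of `exists_nnMoment_le` only the Gamma term is of order `N ^ (-q / d)`.
Rescaling by `N + 1` instead of `N` absorbs the floor in the block size. -/
theorem limsup_nnMoment_le_of_mass [IsProbabilityMeasure μ'] {C : ℝ} (hC1 : 1 ≤ C)
    {m₀ : ℕ} (hm₀ : 1 ≤ m₀)
    (hC : ∀ t > 0, μ' {y | t < ‖y‖} ^ m₀ ≤ ENNReal.ofReal (C / t))
    {q : ℝ} (hq : 0 < q) {d : ℕ} (hd : 1 ≤ d) {x : E} {a r : ℝ} (ha : 0 < a) (hr : 0 < r)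
    (hmass : ∀ t ∈ Set.Icc 0 r, a * t ^ d ≤ μ'.real (Metric.closedBall x t)) :
    limsup (fun N : ℕ => ENNReal.ofReal (((N : ℝ) + 1) ^ (q / d)) * nnMoment μ' q N x) atTop ≤
      ENNReal.ofReal (Real.Gamma (1 + q / d) * a ^ (-(q / d))) := by
  obtain ⟨A, hA, K, hK, hbound⟩ := exists_nnMoment_le μ' hC1 hm₀ hC hq hd
  have hd0 : (0 : ℝ) < d := by exact_mod_cast hd
  set s := q / d with hs
  have hs0 : 0 < s := by positivity
  have hG : 0 < Real.Gamma (1 + s) := Real.Gamma_pos_of_pos (by positivity)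
  set T : ℕ → ℝ := fun N => Real.Gamma (1 + s) * a ^ (-s) * (((N : ℝ) + 1) / N) ^ s +
    (2 * ‖x‖ + 4 * C) ^ q * (((N : ℝ) + 1) ^ s * Real.exp (-(N * (a * r ^ d)))) +
    A * (((N : ℝ) + 1) ^ s * (1 / 2 : ℝ) ^ (N / m₀ - K)) with hT
  have hlim : Tendsto T atTop (𝓝 (Real.Gamma (1 + s) * a ^ (-s))) := by
    have h1 : Tendsto (fun N : ℕ => (((N : ℝ) + 1) / N) ^ s) atTop (𝓝 1) := by
      have h0 : Tendsto (fun N : ℕ => ((N : ℝ) + 1) / N) atTop (𝓝 1) := by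
        have h00 := (tendsto_one_div_atTop_nhds_zero_nat (𝕜 := ℝ)).const_add 1
        rw [add_zero] at h00
        refine h00.congr' ?_
        filter_upwards [eventually_ge_atTop 1] with N hN
        have : (N : ℝ) ≠ 0 := by exact_mod_cast (by omega : N ≠ 0)
        field_simp
      simpa using h0.rpow_const (p := s) (Or.inl one_ne_zero)
    have h2 := (tendsto_add_one_rpow_mul_exp (s := s) (c := a * r ^ d) (by positivity)).const_mul
      ((2 * ‖x‖ + 4 * C) ^ q)
    have h3 := (tendsto_add_one_rpow_mul_half_pow (s := s) hm₀ K).const_mul A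
    have h4 := ((h1.const_mul (Real.Gamma (1 + s) * a ^ (-s))).add h2).add h3
    simp only [mul_one, mul_zero, add_zero] at h4
    exact h4
  have hle : ∀ᶠ N : ℕ in atTop,
      ENNReal.ofReal (((N : ℝ) + 1) ^ s) * nnMoment μ' q N x ≤ ENNReal.ofReal (T N) := by
    filter_upwards [eventually_ge_atTop (K * m₀), eventually_ge_atTop 1] with N hN hN1
    have hN0 : (0 : ℝ) < N := by exact_mod_cast hN1
    refine (mul_le_mul_right (hbound x a r ha hr hmass N hN) _).trans_eq ?_
    rw [← ENNReal.ofReal_add (by positivity) (by positivity),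
      ← ENNReal.ofReal_add (by positivity) (by positivity), ← ENNReal.ofReal_mul (by positivity),
      hT]
    beta_reduce
    congr 1
    rw [Real.mul_rpow hN0.le ha.le, Real.div_rpow (by positivity) hN0.le, Real.rpow_neg hN0.le]
    ring
  calc _ ≤ limsup (fun N => ENNReal.ofReal (T N)) atTop := limsup_le_limsup hle
    _ = _ := (ENNReal.tendsto_ofReal hlim).limsup_eq

theorem limsup_nnMoment_le [IsProbabilityMeasure μ']
    (h : StrongSupportCondition vol μ μ' U p) {C : ℝ} (hC1 : 1 ≤ C) {m₀ : ℕ} (hm₀ : 1 ≤ m₀)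
    (hC : ∀ t > 0, μ' {y | t < ‖y‖} ^ m₀ ≤ ENNReal.ofReal (C / t))
    {q : ℝ} (hq : 0 < q) {d : ℕ} (hd : 1 ≤ d) (hdim : Module.finrank ℝ E = d)
    {x : E} (hx : x ∈ U) :
    limsup (fun N : ℕ => ENNReal.ofReal (((N : ℝ) + 1) ^ (q / d)) * nnMoment μ' q N x) atTop ≤
      ENNReal.ofReal (Real.Gamma (1 + q / d) / unitBallVolume vol ^ (q / d) *
        (1 / p x ^ (q / d))) := by
  have hpx := h.pos x hx
  have hv := unitBallVolume_pos vol
  have hb : ∀ b ∈ Set.Ioo (0 : ℝ) 1,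
      limsup (fun N : ℕ => ENNReal.ofReal (((N : ℝ) + 1) ^ (q / d)) * nnMoment μ' q N x) atTop ≤
      ENNReal.ofReal (Real.Gamma (1 + q / d) * (b * p x * unitBallVolume vol) ^ (-(q / d))) := by
    intro b hb
    have hb0 := hb.1
    obtain ⟨r, hr, hmass⟩ := h.exists_mass_ge hx hb.1 hb.2
    rw [hdim] at hmass
    exact limsup_nnMoment_le_of_mass hC1 hm₀ hC hq hd (by positivity) hr hmass
  have hlim : Tendsto (fun b : ℝ => ENNReal.ofReal
      (Real.Gamma (1 + q / d) * (b * p x * unitBallVolume vol) ^ (-(q / d)))) (𝓝[<] 1)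
      (𝓝 (ENNReal.ofReal
        (Real.Gamma (1 + q / d) * (1 * p x * unitBallVolume vol) ^ (-(q / d))))) := by
    refine ENNReal.tendsto_ofReal (Tendsto.mono_left ?_ nhdsWithin_le_nhds)
    have hcont : ContinuousAt (fun b : ℝ =>
        Real.Gamma (1 + q / d) * (b * p x * unitBallVolume vol) ^ (-(q / d))) 1 := by
      refine continuousAt_const.mul (ContinuousAt.rpow_const (by fun_prop) (Or.inl ?_))
      positivity
    exact hcont
  -- The left side does not depend on `b`, so `b` may tend to `1` from below.
  refine (ge_of_tendsto hlim ?_).trans_eq ?_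
  · filter_upwards [Ioo_mem_nhdsLT one_pos] with b hbm using hb b hbm
  · congr 1
    rw [one_mul, Real.rpow_neg (by positivity), Real.mul_rpow hpx.le hv.le]
    field_simp

theorem two_mul_add_rpow_le {q C u : ℝ} (hq : 0 ≤ q) (hC : 1 ≤ C) (hu : 0 ≤ u) :
    (2 * u + 4 * C) ^ q ≤ (8 * C) ^ q * (1 + u ^ q) := by
  have h0 : 0 ≤ u ^ q := by positivity
  have h8 : 0 ≤ (8 * C) ^ q := by positivity
  rcases le_total u 1 with h | h
  · calc (2 * u + 4 * C) ^ q ≤ (8 * C) ^ q := by gcongr; linarith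
      _ ≤ (8 * C) ^ q * (1 + u ^ q) := by nlinarith
  · calc (2 * u + 4 * C) ^ q ≤ (8 * C * u) ^ q := by gcongr; nlinarith
      _ = (8 * C) ^ q * u ^ q := Real.mul_rpow (by linarith) hu
      _ ≤ (8 * C) ^ q * (1 + u ^ q) := by nlinarith

/-- Under a minimal mass condition that is uniform over the support, the rescaled nearest
neighbor moments are dominated by an integrable function. -/
theorem exists_integrable_nnMoment_le [IsProbabilityMeasure μ] [IsProbabilityMeasure μ']
    (h : StrongSupportCondition vol μ μ' U p) {C : ℝ} (hC1 : 1 ≤ C) {m₀ : ℕ} (hm₀ : 1 ≤ m₀)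
    (hC : ∀ t > 0, μ' {y | t < ‖y‖} ^ m₀ ≤ ENNReal.ofReal (C / t))
    {q : ℝ} (hq : 0 < q) {d : ℕ} (hd : 1 ≤ d) (hdim : Module.finrank ℝ E = d)
    (hmom : Integrable (fun x => (1 + ‖x‖ ^ q) / p x ^ (q / d)) μ) :
    ∃ g : E → ℝ, Integrable g μ ∧ ∃ N₀ : ℕ, ∀ N ≥ N₀, ∀ x ∈ U,
      ENNReal.ofReal (((N : ℝ) + 1) ^ (q / d)) * nnMoment μ' q N x ≤ ENNReal.ofReal (g x) := by
  obtain ⟨A, hA, K, hK, hbound⟩ := exists_nnMoment_le μ' hC1 hm₀ hC hq hd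
  obtain ⟨κ, ⟨hκ0, hκ1⟩, r, hr, hmass⟩ := h.minimal_mass
  rw [hdim] at hmass
  have hv := unitBallVolume_pos vol
  have hd0 : (0 : ℝ) < d := by exact_mod_cast hd
  set s := q / d with hs
  have hs0 : 0 < s := by positivity
  have hG : 0 < Real.Gamma (1 + s) := Real.Gamma_pos_of_pos (by positivity)
  obtain ⟨B, hB⟩ := (tendsto_add_one_rpow_mul_half_pow (s := s) hm₀ K).bddAbove_range
  set v := unitBallVolume vol with hvdef
  set D := 2 ^ s * (Real.Gamma (1 + s) * (κ * v) ^ (-s) +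
    (8 * C) ^ q * s ^ s * (κ * v * r ^ d) ^ (-s)) with hD
  refine ⟨fun x => D * ((1 + ‖x‖ ^ q) / p x ^ s) + A * B,
    (hmom.const_mul D).add (integrable_const _), K * m₀, fun N hN x hx => ?_⟩
  have hN1 : 1 ≤ N := le_trans (Nat.mul_le_mul hK hm₀) hN
  have hN0 : (0 : ℝ) < N := by exact_mod_cast hN1
  have hpx := h.pos x hx
  have ha : 0 < κ * p x * v := by positivity
  refine (mul_le_mul_right (hbound x _ r ha hr (hmass x hx) N hN) _).trans ?_
  rw [← ENNReal.ofReal_add (by positivity) (by positivity),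
    ← ENNReal.ofReal_add (by positivity) (by positivity), ← ENNReal.ofReal_mul (by positivity)]
  refine ENNReal.ofReal_le_ofReal ?_
  have hw : ((N : ℝ) + 1) ^ s ≤ 2 ^ s * N ^ s := by
    rw [← Real.mul_rpow two_pos.le hN0.le]
    have : (1 : ℝ) ≤ N := by exact_mod_cast hN1
    gcongr
    linarith
  have hx0 : 0 ≤ ‖x‖ ^ q := by positivity
  have hNs : (0 : ℝ) < N ^ s := by positivity
  have hps : 0 < p x ^ s := by positivity
  have h1 : ((N : ℝ) + 1) ^ s * (Real.Gamma (1 + s) * (N * (κ * p x * v)) ^ (-s)) ≤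
      2 ^ s * (Real.Gamma (1 + s) * (κ * v) ^ (-s)) * ((1 + ‖x‖ ^ q) / p x ^ s) := by
    calc _ ≤ 2 ^ s * N ^ s * (Real.Gamma (1 + s) * (N * (κ * p x * v)) ^ (-s)) := by gcongr
      _ = 2 ^ s * (Real.Gamma (1 + s) * (κ * v) ^ (-s)) * (1 / p x ^ s) := by
        rw [show (N : ℝ) * (κ * p x * v) = N * (κ * v) * p x by ring,
          Real.mul_rpow (by positivity) hpx.le, Real.mul_rpow hN0.le (by positivity),
          Real.rpow_neg hN0.le, Real.rpow_neg hpx.le]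
        field_simp
      _ ≤ _ := by gcongr; linarith
  -- This term requires the weight `1 + ‖x‖ ^ q` in the moment assumption: the radius `2 * ‖x‖ + 4 *
  -- C` supplies it, and the exponential supplies `p x ^ (-s)`.
  have h2 : ((N : ℝ) + 1) ^ s * ((2 * ‖x‖ + 4 * C) ^ q *
      Real.exp (-(N * (κ * p x * v * r ^ d)))) ≤
      2 ^ s * ((8 * C) ^ q * s ^ s * (κ * v * r ^ d) ^ (-s)) * ((1 + ‖x‖ ^ q) / p x ^ s) := by
    have hy := rpow_mul_exp_neg_le hs0 (y := N * (κ * p x * v * r ^ d)) (by positivity)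
    calc _ ≤ 2 ^ s * N ^ s * ((8 * C) ^ q * (1 + ‖x‖ ^ q) *
          Real.exp (-(N * (κ * p x * v * r ^ d)))) := by
          gcongr
          exact two_mul_add_rpow_le hq.le hC1 (norm_nonneg x)
      _ = 2 ^ s * ((8 * C) ^ q * (κ * v * r ^ d) ^ (-s)) * ((1 + ‖x‖ ^ q) / p x ^ s) *
          ((N * (κ * p x * v * r ^ d)) ^ s * Real.exp (-(N * (κ * p x * v * r ^ d)))) := by
          rw [show (N : ℝ) * (κ * p x * v * r ^ d) = N * (κ * v * r ^ d) * p x by ring,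
            Real.mul_rpow (by positivity) hpx.le, Real.mul_rpow hN0.le (by positivity),
            Real.rpow_neg (by positivity)]
          field_simp
      _ ≤ 2 ^ s * ((8 * C) ^ q * (κ * v * r ^ d) ^ (-s)) * ((1 + ‖x‖ ^ q) / p x ^ s) *
          s ^ s := by gcongr
      _ = _ := by ring
  have h3 : ((N : ℝ) + 1) ^ s * (A * (1 / 2) ^ (N / m₀ - K)) ≤ A * B := by
    rw [mul_left_comm]
    exact mul_le_mul_of_nonneg_left (hB ⟨N, rfl⟩) hA
  calc _ = ((N : ℝ) + 1) ^ s * (Real.Gamma (1 + s) * (N * (κ * p x * v)) ^ (-s)) +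
        ((N : ℝ) + 1) ^ s * ((2 * ‖x‖ + 4 * C) ^ q * Real.exp (-(N * (κ * p x * v * r ^ d)))) +
        ((N : ℝ) + 1) ^ s * (A * (1 / 2) ^ (N / m₀ - K)) := by ring
    _ ≤ _ := add_le_add (add_le_add h1 h2) h3
    _ = _ := by rw [hD]; ring

/-- Reverse Fatou, after a shift by `N₀` since the domination only holds from there on. -/
theorem limsup_lintegral_nnMoment_le [IsProbabilityMeasure μ] [IsProbabilityMeasure μ']
    (h : StrongSupportCondition vol μ μ' U p) {C : ℝ} (hC1 : 1 ≤ C) {m₀ : ℕ} (hm₀ : 1 ≤ m₀)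
    (hC : ∀ t > 0, μ' {y | t < ‖y‖} ^ m₀ ≤ ENNReal.ofReal (C / t))
    {q : ℝ} (hq : 0 < q) {d : ℕ} (hd : 1 ≤ d) (hdim : Module.finrank ℝ E = d)
    (hmom : Integrable (fun x => (1 + ‖x‖ ^ q) / p x ^ (q / d)) μ) :
    limsup (fun N : ℕ => ENNReal.ofReal (((N : ℝ) + 1) ^ (q / d)) *
      ∫⁻ x, nnMoment μ' q N x ∂μ) atTop ≤
      ENNReal.ofReal (Real.Gamma (1 + q / d) / unitBallVolume vol ^ (q / d) *
        ∫ x, 1 / p x ^ (q / d) ∂μ) := by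
  have hv := unitBallVolume_pos vol
  have hG : 0 < Real.Gamma (1 + q / d) := Real.Gamma_pos_of_pos (by positivity)
  obtain ⟨g, hg, N₀, hdom⟩ := exists_integrable_nnMoment_le h hC1 hm₀ hC hq hd hdim hmom
  set f : ℕ → E → ℝ≥0∞ := fun N x =>
    ENNReal.ofReal (((N : ℝ) + 1) ^ (q / d)) * nnMoment μ' q N x with hf
  have hfm : ∀ N, Measurable (f N) := fun N => (measurable_nnMoment μ' q N).const_mul _
  have hint : ∀ N : ℕ, ENNReal.ofReal (((N : ℝ) + 1) ^ (q / d)) *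
      ∫⁻ x, nnMoment μ' q N x ∂μ = ∫⁻ x, f N x ∂μ := fun N =>
    (lintegral_const_mul _ (measurable_nnMoment μ' q N)).symm
  simp only [hint]
  rw [← limsup_nat_add (fun N => ∫⁻ x, f N x ∂μ) N₀]
  calc _ ≤ ∫⁻ x, limsup (fun N => f (N + N₀) x) atTop ∂μ := by
        refine limsup_lintegral_le (fun x => ENNReal.ofReal (g x)) (fun N => hfm _) (fun N => ?_)
          hg.lintegral_lt_top.ne
        filter_upwards [h.ae_mem] with x hx using hdom _ (Nat.le_add_left _ _) x hx
    _ ≤ ∫⁻ x, ENNReal.ofReal (Real.Gamma (1 + q / d) / unitBallVolume vol ^ (q / d) *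
        (1 / p x ^ (q / d))) ∂μ := by
        refine lintegral_mono_ae ?_
        filter_upwards [h.ae_mem] with x hx
        rw [limsup_nat_add (fun N => f N x) N₀]
        exact limsup_nnMoment_le h hC1 hm₀ hC hq hd hdim hx
    _ = _ := by
        rw [← integral_const_mul, ofReal_integral_eq_lintegral_ofReal
          ((h.integrable_one_div_rpow hmom).const_mul _)]
        filter_upwards [h.ae_mem] with x hx
        have hpx := h.pos x hx
        simp only [Pi.zero_apply]
        positivity

end Density

/-! ### The constant -/

/-- The average of `(l / k) ^ s` over `1 ≤ l ≤ k`. -/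
noncomputable def rpowAverage (s : ℝ) (k : ℕ) : ℝ :=
  (k : ℝ)⁻¹ * ∑ l ∈ Finset.range k, (((l : ℝ) + 1) / k) ^ s

theorem sum_add_one_rpow_ge {s : ℝ} (hs : 0 < s) (k : ℕ) :
    (k : ℝ) ^ (s + 1) / (s + 1) ≤ ∑ l ∈ Finset.range k, ((l : ℝ) + 1) ^ s := by
  have hmono : MonotoneOn (fun x : ℝ => x ^ s) (Set.Icc 0 (0 + k)) := fun x hx y _ hxy =>
    Real.rpow_le_rpow hx.1 hxy hs.le
  have h := hmono.integral_le_sum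
  rw [integral_rpow (Or.inl (by linarith)), zero_add, Real.zero_rpow (by positivity),
    sub_zero] at h
  simpa using h

theorem sum_add_one_rpow_le {s : ℝ} (hs : 0 < s) (k : ℕ) :
    ∑ l ∈ Finset.range k, ((l : ℝ) + 1) ^ s ≤ (k : ℝ) ^ (s + 1) / (s + 1) + (k : ℝ) ^ s := by
  have hmono : MonotoneOn (fun x : ℝ => x ^ s) (Set.Icc 0 (0 + k)) := fun x hx y _ hxy =>
    Real.rpow_le_rpow hx.1 hxy hs.le
  have h := hmono.sum_le_integral
  rw [integral_rpow (Or.inl (by linarith)), zero_add, Real.zero_rpow (by positivity),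
    sub_zero] at h
  simp only [zero_add] at h
  have h2 : ∑ l ∈ Finset.range k, ((l : ℝ) + 1) ^ s =
      ∑ l ∈ Finset.range k, (l : ℝ) ^ s + (k : ℝ) ^ s := by
    rw [← Finset.sum_range_succ (fun l : ℕ => (l : ℝ) ^ s), Finset.sum_range_succ',
      Nat.cast_zero, Real.zero_rpow hs.ne', add_zero]
    simp
  rw [h2]
  linarith

theorem rpowAverage_eq {s : ℝ} {k : ℕ} (hk : 1 ≤ k) :
    rpowAverage s k = (∑ l ∈ Finset.range k, ((l : ℝ) + 1) ^ s) / (k : ℝ) ^ (s + 1) := by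
  have hk0 : (0 : ℝ) < k := by exact_mod_cast hk
  have h : ∀ l ∈ Finset.range k, (((l : ℝ) + 1) / k) ^ s = ((l : ℝ) + 1) ^ s / (k : ℝ) ^ s :=
    fun l _ => Real.div_rpow (by positivity) hk0.le s
  rw [rpowAverage, Finset.sum_congr rfl h, ← Finset.sum_div, Real.rpow_add_one hk0.ne']
  field_simp

theorem one_div_le_rpowAverage {s : ℝ} (hs : 0 < s) {k : ℕ} (hk : 1 ≤ k) :
    1 / (s + 1) ≤ rpowAverage s k := by
  have hk0 : (0 : ℝ) < k := by exact_mod_cast hk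
  rw [rpowAverage_eq hk, le_div_iff₀ (by positivity), one_div_mul_eq_div]
  exact sum_add_one_rpow_ge hs k

theorem rpowAverage_le_add {s : ℝ} (hs : 0 < s) {k : ℕ} (hk : 1 ≤ k) :
    rpowAverage s k ≤ 1 / (s + 1) + 1 / k := by
  have hk0 : (0 : ℝ) < k := by exact_mod_cast hk
  rw [rpowAverage_eq hk, div_le_iff₀ (by positivity)]
  refine (sum_add_one_rpow_le hs k).trans_eq ?_
  rw [Real.rpow_add_one hk0.ne']
  field_simp

theorem rpowAverage_le_one {s : ℝ} (hs : 0 < s) {k : ℕ} (hk : 1 ≤ k) : rpowAverage s k ≤ 1 := by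
  have hk0 : (0 : ℝ) < k := by exact_mod_cast hk
  have h : ∑ l ∈ Finset.range k, (((l : ℝ) + 1) / k) ^ s ≤ ∑ l ∈ Finset.range k, (1 : ℝ) := by
    refine Finset.sum_le_sum fun l hl => Real.rpow_le_one (by positivity) ?_ hs.le
    rw [div_le_one hk0]
    exact_mod_cast Finset.mem_range.1 hl
  rw [Finset.sum_const, Finset.card_range, nsmul_eq_mul, mul_one] at h
  rw [rpowAverage, inv_mul_le_iff₀ hk0, mul_one]
  exact h

theorem knnConst_of_bddAbove {d : ℕ} {q : ℝ} {k : ℕ → ℕ} (h : BddAbove (Set.range k)) :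
    knnConst d q k = 2 ^ (q / d + 1) * rpowAverage (q / d) (⨆ m, k m) := by
  rw [knnConst, if_pos h, rpowAverage, ← mul_assoc, div_eq_mul_inv]
  congr 1
  rw [← Finset.Ico_add_one_right_eq_Icc, Finset.range_eq_Ico]
  have := Finset.sum_Ico_add' (fun l : ℕ => ((l : ℝ) / ((⨆ m, k m : ℕ) : ℝ)) ^ (q / d))
    0 (⨆ m, k m) 1
  rw [zero_add] at this
  rw [← this]
  simp

theorem knnConst_of_not_bddAbove {d : ℕ} {q : ℝ} {k : ℕ → ℕ} (h : ¬ BddAbove (Set.range k)) :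
    knnConst d q k = 2 ^ (q / d + 1) * (1 / (q / d + 1)) := by
  rw [knnConst, if_neg h, mul_one_div]

theorem one_le_iSup_of_bddAbove {k : ℕ → ℕ} (hkpos : ∀ m, 1 ≤ k m)
    (h : BddAbove (Set.range k)) : 1 ≤ ⨆ m, k m :=
  (hkpos 0).trans (le_ciSup h 0)

/-- The average is at least `1 / (s + 1)` with `s = q / d`, and Bernoulli's strict inequality gives
`2 ^ (s + 1) > s + 2`. -/
theorem one_lt_knnConst {d : ℕ} {q : ℝ} (hs : 0 < q / d) {k : ℕ → ℕ} (hkpos : ∀ m, 1 ≤ k m) :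
    1 < knnConst d q k := by
  have h1 : 1 < (2 : ℝ) ^ (q / d + 1) * (1 / (q / d + 1)) := by
    rw [mul_one_div, one_lt_div (by positivity)]
    have := one_add_mul_self_lt_rpow_one_add (s := 1) (by norm_num) one_ne_zero
      (p := q / d + 1) (by linarith)
    rw [show (1 : ℝ) + 1 = 2 by norm_num] at this
    linarith
  by_cases h : BddAbove (Set.range k)
  · rw [knnConst_of_bddAbove h]
    refine h1.trans_le ?_
    gcongr
    exact one_div_le_rpowAverage hs (one_le_iSup_of_bddAbove hkpos h)
  · rwa [knnConst_of_not_bddAbove h]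

theorem knnConst_le {d : ℕ} {q : ℝ} (hs : 0 < q / d) {k : ℕ → ℕ} (hkpos : ∀ m, 1 ≤ k m) :
    knnConst d q k ≤ 2 ^ (q / d + 1) := by
  have h2 : (0 : ℝ) < 2 ^ (q / d + 1) := by positivity
  by_cases h : BddAbove (Set.range k)
  · rw [knnConst_of_bddAbove h]
    exact mul_le_of_le_one_right h2.le
      (rpowAverage_le_one hs (one_le_iSup_of_bddAbove hkpos h))
  · rw [knnConst_of_not_bddAbove h]
    refine mul_le_of_le_one_right h2.le ?_
    rw [div_le_one (by positivity)]
    linarith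

/-- A nondecreasing integer sequence is either eventually equal to its supremum or tends to
infinity; in the second case the averages are squeezed between `1 / (s + 1)` and `1 / (s + 1) + 1 /
k`, by comparison with an integral. -/
theorem tendsto_mul_rpowAverage {d : ℕ} {q : ℝ} (hs : 0 < q / d) {k : ℕ → ℕ}
    (hkpos : ∀ m, 1 ≤ k m) (hkmono : Monotone k) :
    Tendsto (fun m => 2 ^ (q / d + 1) * rpowAverage (q / d) (k m)) atTop
      (𝓝 (knnConst d q k)) := by
  by_cases h : BddAbove (Set.range k)
  · rw [knnConst_of_bddAbove h]
    obtain ⟨m₁, hm₁⟩ : (⨆ m, k m) ∈ Set.range k := Nat.sSup_mem (Set.range_nonempty k) h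
    refine tendsto_const_nhds.congr' ?_
    filter_upwards [eventually_ge_atTop m₁] with m hm
    rw [le_antisymm (le_ciSup h m) (hm₁ ▸ hkmono hm)]
  · rw [knnConst_of_not_bddAbove h]
    refine Tendsto.const_mul _ ?_
    have hkt : Tendsto k atTop atTop :=
      (tendsto_atTop_of_monotone hkmono).resolve_right fun ⟨l, hl⟩ => h hl.bddAbove_range
    have h1 : Tendsto (fun m => 1 / (q / d + 1) + 1 / (k m : ℝ)) atTop
        (𝓝 (1 / (q / d + 1))) := by
      simpa using (tendsto_one_div_atTop_nhds_zero_nat (𝕜 := ℝ)).comp hkt |>.const_add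
        (1 / (q / d + 1))
    exact tendsto_of_tendsto_of_tendsto_of_le_of_le tendsto_const_nhds h1
      (fun m => one_div_le_rpowAverage hs (hkpos m)) (fun m => rpowAverage_le_add hs (hkpos m))

/-! ### Averaging over ranks and conclusion -/

/-- With `N = m / (2 * (l + 1))`, flooring gives `m ≤ 2 * (l + 1) * (N + 1)`, so `m / k` is at most
`2 * ((l + 1) / k) * (N + 1)`, with no loss in the constant. -/
theorem ofReal_mul_average_le {s : ℝ} (hs : 0 < s) {k m : ℕ} (hk : 1 ≤ k) (F : ℕ → ℝ≥0∞)
    {ℓ : ℝ} (hF : ∀ l < k, ENNReal.ofReal (((m / (2 * (l + 1)) : ℕ) + 1 : ℝ) ^ s) *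
      F (m / (2 * (l + 1))) ≤ ENNReal.ofReal ℓ) :
    ENNReal.ofReal (((m : ℝ) / k) ^ s) *
      ((k : ℝ≥0∞)⁻¹ * ∑ l ∈ Finset.range k, 2 * F (m / (2 * (l + 1)))) ≤
      ENNReal.ofReal (2 ^ (s + 1) * rpowAverage s k * ℓ) := by
  have hk0 : (0 : ℝ) < k := by exact_mod_cast hk
  have hterm : ∀ l ∈ Finset.range k, ENNReal.ofReal (((m : ℝ) / k) ^ s) *
      (2 * F (m / (2 * (l + 1)))) ≤
      ENNReal.ofReal (2 ^ (s + 1) * (((l : ℝ) + 1) / k) ^ s * ℓ) := by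
    intro l hl
    set N := m / (2 * (l + 1)) with hN
    have hm : (m : ℝ) ≤ 2 * (l + 1) * (N + 1) := by
      have : m < 2 * (l + 1) * (N + 1) := Nat.lt_mul_div_succ m (by positivity)
      exact_mod_cast this.le
    have hle : ((m : ℝ) / k) ^ s ≤ 2 ^ s * (((l : ℝ) + 1) / k) ^ s * ((N : ℝ) + 1) ^ s := by
      rw [← Real.mul_rpow (by positivity) (by positivity),
        ← Real.mul_rpow (by positivity) (by positivity)]
      refine Real.rpow_le_rpow (by positivity) ?_ hs.le
      rw [div_le_iff₀ hk0]
      refine hm.trans_eq ?_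
      field_simp
    calc ENNReal.ofReal (((m : ℝ) / k) ^ s) * (2 * F N)
        ≤ ENNReal.ofReal (2 ^ s * (((l : ℝ) + 1) / k) ^ s * ((N : ℝ) + 1) ^ s) * (2 * F N) := by
          gcongr
      _ = ENNReal.ofReal (2 ^ (s + 1) * (((l : ℝ) + 1) / k) ^ s) *
          (ENNReal.ofReal (((N : ℝ) + 1) ^ s) * F N) := by
          rw [Real.rpow_add_one two_ne_zero, ENNReal.ofReal_mul (by positivity),
            mul_right_comm _ (2 : ℝ), ENNReal.ofReal_mul (p := _ * _) (q := 2) (by positivity),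
            ENNReal.ofReal_ofNat]
          ring
      _ ≤ ENNReal.ofReal (2 ^ (s + 1) * (((l : ℝ) + 1) / k) ^ s) * ENNReal.ofReal ℓ := by
          gcongr
          exact hF l (Finset.mem_range.1 hl)
      _ = _ := (ENNReal.ofReal_mul (by positivity)).symm
  have hkinv : (k : ℝ≥0∞)⁻¹ = ENNReal.ofReal (k : ℝ)⁻¹ := by
    rw [ENNReal.ofReal_inv_of_pos hk0, ENNReal.ofReal_natCast]
  -- For negative `ℓ` the bound truncates to zero and forces every term to vanish.
  rcases le_or_gt 0 ℓ with hℓ | hℓ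
  · rw [mul_left_comm, Finset.mul_sum]
    calc _ ≤ (k : ℝ≥0∞)⁻¹ * ∑ l ∈ Finset.range k,
          ENNReal.ofReal (2 ^ (s + 1) * (((l : ℝ) + 1) / k) ^ s * ℓ) := by
          gcongr with l hl; exact hterm l hl
      _ = _ := by
        rw [← ENNReal.ofReal_sum_of_nonneg fun l _ => by positivity, hkinv,
          ← ENNReal.ofReal_mul (by positivity), rpowAverage, ← Finset.sum_mul, ← Finset.mul_sum]
        congr 1; ring
  · rw [mul_left_comm, Finset.mul_sum, Finset.sum_eq_zero, mul_zero]
    · exact zero_le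
    · intro l hl
      refine le_antisymm ((hterm l hl).trans_eq (ENNReal.ofReal_of_nonpos ?_)) zero_le
      exact mul_nonpos_of_nonneg_of_nonpos (by positivity) hℓ.le

theorem eventually_mul_le_of_tendsto_div {k : ℕ → ℕ}
    (hk : Tendsto (fun m => (k m : ℝ) / m) atTop (𝓝 0)) (M : ℕ) :
    ∀ᶠ m in atTop, k m * M ≤ m := by
  have hM : (0 : ℝ) < 1 / ((M : ℝ) + 1) := by positivity
  filter_upwards [hk.eventually_lt_const hM, eventually_ge_atTop 1] with m hm hm1
  have hm0 : (0 : ℝ) < m := by exact_mod_cast hm1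
  rw [div_lt_div_iff₀ hm0 (by positivity), one_mul] at hm
  have hk0 : (0 : ℝ) ≤ k m := by positivity
  have : (k m : ℝ) * M ≤ m := by linarith
  exact_mod_cast this

end NNRates

theorem corollary3p7
    -- the space `ℝ^d` with an arbitrary norm and its Lebesgue (Haar) measure `vol`
    {E : Type*} [NormedAddCommGroup E] [NormedSpace ℝ E] [FiniteDimensional ℝ E]
    [MeasurableSpace E] [BorelSpace E]
    (d : ℕ) (hd : 1 ≤ d) (hdim : Module.finrank ℝ E = d)
    (vol : Measure E) [vol.IsAddHaarMeasure]
    -- the two independent i.i.d. samples, with laws `μ` and `μ'`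
    {Ω : Type*} [MeasurableSpace Ω] (P : Measure Ω) [IsProbabilityMeasure P]
    (μ μ' : Measure E) [IsProbabilityMeasure μ] [IsProbabilityMeasure μ']
    (X X' : ℕ → Ω → E)
    (hXlaw : ∀ i, HasLaw (X i) μ P) (hX'law : ∀ j, HasLaw (X' j) μ' P)
    (hXindep : iIndepFun X P) (hX'indep : iIndepFun X' P)
    (hXX' : IndepFun (fun ω i => X i ω) (fun ω j => X' j ω) P)
    -- min-integrability
    (hmin : ∃ m₀ : ℕ, 1 ≤ m₀ ∧ ∫⁻ ω, ⨅ j : Fin m₀, ‖X' j ω‖ₑ ∂P < ∞)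
    -- strong support condition
    (U : Set E) (p : E → ℝ) (hsupp : NNRates.StrongSupportCondition vol μ μ' U p)
    -- moments
    (q : ℝ) (hq : 1 ≤ q)
    (hmom : Integrable (fun x => (1 + ‖x‖ ^ q) / p x ^ (q / d)) μ)
    -- the numbers of neighbors `k m` and the sizes `n m` of the evaluation sample
    (k : ℕ → ℕ) (hkpos : ∀ m, 1 ≤ k m) (hkmono : Monotone k)
    (hk : Tendsto (fun m => (k m : ℝ) / m) atTop (𝓝 0))
    (n : ℕ → ℕ) (hn : ∀ m, 1 ≤ n m) :
    1 < NNRates.knnConst d q k ∧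
    NNRates.knnConst d q k ≤ 2 ^ (q / d + 1) ∧
    limsup (fun m : ℕ => ENNReal.ofReal (((m : ℝ) / k m) ^ (q / d)) *
        ∫⁻ ω, NNRates.wasserstein q
          (NNRates.empiricalMeasure (fun i : Fin (n m) => X i ω))
          (NNRates.knnMeasure (k m) (fun i : Fin (n m) => X i ω)
            (fun j : Fin m => X' j ω)) ^ q ∂P) atTop
      ≤ ENNReal.ofReal (NNRates.knnConst d q k *
          (Real.Gamma (1 + q / d) / NNRates.unitBallVolume vol ^ (q / d)) *
          ∫ x, 1 / p x ^ (q / d) ∂μ) := by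
  have hq0 : 0 < q := by linarith
  have hd0 : (0 : ℝ) < d := by exact_mod_cast hd
  have hs : 0 < q / d := by positivity
  refine ⟨NNRates.one_lt_knnConst hs hkpos, NNRates.knnConst_le hs hkpos, ?_⟩
  obtain ⟨m₀, hm₀, hmin⟩ := hmin
  obtain ⟨C, hC1, hC⟩ := NNRates.exists_survival_pow_le hX'law hX'indep hmin
  have hL := NNRates.limsup_lintegral_nnMoment_le hsupp hC1 hm₀ hC hq0 hd hdim hmom
  set ℓ := Real.Gamma (1 + q / d) / NNRates.unitBallVolume vol ^ (q / d) *
    ∫ x, 1 / p x ^ (q / d) ∂μ with hℓ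
  have hℓ0 : 0 ≤ ℓ := by
    have hv := NNRates.unitBallVolume_pos vol
    have hG : 0 < Real.Gamma (1 + q / d) := Real.Gamma_pos_of_pos (by positivity)
    refine mul_nonneg (by positivity) (integral_nonneg_of_ae ?_)
    filter_upwards [hsupp.ae_mem] with x hx
    have hpx := hsupp.pos x hx
    simp only [Pi.zero_apply]
    positivity
  have hε : ∀ ε > 0, limsup (fun m : ℕ => ENNReal.ofReal (((m : ℝ) / k m) ^ (q / d)) *
        ∫⁻ ω, NNRates.wasserstein q
          (NNRates.empiricalMeasure (fun i : Fin (n m) => X i ω))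
          (NNRates.knnMeasure (k m) (fun i : Fin (n m) => X i ω)
            (fun j : Fin m => X' j ω)) ^ q ∂P) atTop ≤
      ENNReal.ofReal (NNRates.knnConst d q k * (ℓ + ε)) := by
    intro ε hε
    have hlt : ENNReal.ofReal ℓ < ENNReal.ofReal (ℓ + ε) :=
      (ENNReal.ofReal_lt_ofReal_iff (by positivity)).2 (by linarith)
    -- The slack `ε` turns the limsup into a bound valid for every sample size `N ≥ M`, as needed to
    -- treat all ranks at once.
    obtain ⟨M, hM⟩ := eventually_atTop.1 (eventually_lt_of_limsup_lt (hL.trans_lt hlt))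
    have hlim := ENNReal.tendsto_ofReal
      ((NNRates.tendsto_mul_rpowAverage hs hkpos hkmono).mul_const (ℓ + ε))
    rw [← hlim.limsup_eq]
    refine limsup_le_limsup ?_
    -- Once `2 * M * k m ≤ m`, the block sizes `m / (2 * (l + 1))` are at least `M` simultaneously
    -- for all `l < k m`.
    filter_upwards [NNRates.eventually_mul_le_of_tendsto_div hk 1,
      NNRates.eventually_mul_le_of_tendsto_div hk (2 * M)] with m hm1 hm2
    rw [mul_one] at hm1
    refine (mul_le_mul_right (NNRates.lintegral_wasserstein_rpow_le hXlaw hX'law hX'indep hXX'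
      hq0 (hkpos m) hm1 (hn m) (fun l => m / (2 * (l + 1)))
      fun l => Nat.mul_div_le m _) _).trans ?_
    refine NNRates.ofReal_mul_average_le hs (hkpos m) (fun N => ∫⁻ x, NNRates.nnMoment μ' q N x ∂μ)
      fun l hl => (hM _ ?_).le
    rw [Nat.le_div_iff_mul_le (by positivity)]
    calc M * (2 * (l + 1)) ≤ M * (2 * k m) := by gcongr; omega
      _ = k m * (2 * M) := by ring
      _ ≤ m := hm2
  rw [mul_assoc, ← hℓ]
  have hlim : Tendsto (fun ε : ℝ => ENNReal.ofReal (NNRates.knnConst d q k * (ℓ + ε)))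
      (𝓝[>] 0) (𝓝 (ENNReal.ofReal (NNRates.knnConst d q k * (ℓ + 0)))) := by
    refine ENNReal.tendsto_ofReal (Tendsto.mono_left ?_ nhdsWithin_le_nhds)
    exact (tendsto_const_nhds.add tendsto_id).const_mul _
  rw [add_zero] at hlim
  exact ge_of_tendsto hlim (by filter_upwards [self_mem_nhdsWithin] with ε h using hε ε h)
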